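/- Let $\alpha,c>0$, let $N=(N_t)_{t\ge 0}$ be a Poisson process of intensity $\alpha$ and let $(Z_k)_{k\ge 1}$ be i.i.d. non-negative random variables with distribution $G$, not almost surely equal to $0$, independent of $N$; write $Z$ for a variable with law $G$ and $m=\mathbb{E}(Z)$. For $x\ge 0$ let $$R_t^x=x+ct-\sum_{k=1}^{N_t}Z_k,\qquad \psi(x)=\mathbb{P}\Big(\inf_{t\ge 0}R_t^x<0\Big).$$ Assume that $\mathbb{E}(e^{sZ})<\infty$ for all $s>0$ and that $c-\alpha m>0$. Put $\bar G(y)=\mathbb{P}(Z>y)$. Then the equation $\int_0^\infty e^{sy}\frac{\alpha}{c}\bar G(y)\,dy=1$ has exactly one real solution $s=\kappa$, and $\kappa>0$. The measure $F(dx)=e^{\kappa x}\frac{\alpha}{c}\bar G(x)\,dx$ on $[0,\infty)$ is a probability measure, and its moment generating function $g(z)=\int_0^\infty e^{zx}F(dx)$ is an entire function of $z\in\mathbb{C}$. Moreover: 1. For every $r>0$ the equation $g(z)=1$ has only finitely many solutions with $\mathrm{Re}(z)\le r$; let $z_0=0,z_1,\dots,z_N$ be the distinct ones. Then $$\psi(x)=\sum_{j=0}^N\mathrm{Res}\left(\frac{(\alpha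 m-c)e^{-x(z+\kappa)}}{c(1-g(z))(z+\kappa)};z_j\right)+o\big(e^{-(r+\kappa)x}\big)\qquad\text{as }x\to+\infty.$$ 2. If $z_j$ is a simple zero of $g-1$, i.e. $g'(z_j)\ne 0$, then the $j$-th term of this sum equals $$-\frac{\alpha m-c}{c\,g'(z_j)(z_j+\kappa)}e^{-x(z_j+\kappa)}=\frac{c-\alpha m}{\alpha\,\mathbb{E}\big(Ze^{(z_j+\kappa)Z}\big)-c}\,e^{-(z_j+\kappa)x}.$$ 3. The zero $z_0=0$ is simple, and the term $j=0$ is the Cramér–Lundberg approximation: it equals $Ce^{-\kappa x}$ with $C=\dfrac{c-\alpha m}{\alpha\,\mathbb{E}(Ze^{\kappa Z})-c}$, and $\psi(x)\sim Ce^{-\kappa x}$ as $x\to+\infty$. -/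

import Mathlib

open MeasureTheory ProbabilityTheory Filter Topology Asymptotics
open scoped NNReal ENNReal

noncomputable section

namespace RuinTheory

/-- `N` is (a version of) a Poisson process of intensity `α`: the counting process of a sequence of
arrivals whose inter-arrival times `T 0, T 1, …` are independent and exponentially distributed with
parameter `α`. The `n`-th arrival time is `T 0 + ⋯ + T (n - 1)`, and, almost surely, for all `t`,
`N t` is the number of arrivals in `(0, t]`, i.e. `n ≤ N t` iff the `n`-th arrival is at or before `t`. -/
structure IsPoissonProcess {Ω : Type*} [MeasurableSpace Ω] (P : Measure Ω) (α : ℝ)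
    (N : ℝ≥0 → Ω → ℕ) : Prop where
  measurable : ∀ t, Measurable (N t)
  exists_interarrival : ∃ T : ℕ → Ω → ℝ,
    (∀ k, Measurable (T k)) ∧ (∀ k, P.map (T k) = expMeasure α) ∧ iIndepFun T P ∧
    ∀ᵐ ω ∂P, ∀ (t : ℝ≥0) (n : ℕ), n ≤ N t ω ↔ ∑ k ∈ Finset.range n, T k ω ≤ (t : ℝ)

/-- The risk process `R_t^x = x + c t - ∑_{k ≤ N_t} Z_k` (claims are indexed from `0`). -/
def riskProcess {Ω : Type*} (c : ℝ) (N : ℝ≥0 → Ω → ℕ) (Z : ℕ → Ω → ℝ) (x : ℝ) (t : ℝ≥0) (ω : Ω) :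
    ℝ :=
  x + c * t - ∑ k ∈ Finset.range (N t ω), Z k ω

/-- The ruin probability `ψ(x) = P(inf_{t ≥ 0} R_t^x < 0)`; the infimum is taken in `[-∞, ∞]`. -/
def ruinProb {Ω : Type*} [MeasurableSpace Ω] (P : Measure Ω) (c : ℝ) (N : ℝ≥0 → Ω → ℕ)
    (Z : ℕ → Ω → ℝ) (x : ℝ) : ℝ :=
  P.real {ω | (⨅ t : ℝ≥0, ((riskProcess c N Z x t ω : ℝ) : EReal)) < 0}

/-- The tail function `1 - G(y) = G((y, ∞))` of a probability distribution `G` on the line. -/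
def tail (G : Measure ℝ) (y : ℝ) : ℝ := G.real (Set.Ioi y)

/-- The Lundberg equation at a real number `s`: `∫_0^∞ e^{s y} (α / c) (1 - G(y)) dy = 1`. -/
def LundbergEq (α c : ℝ) (G : Measure ℝ) (s : ℝ) : Prop :=
  ∫ y in Set.Ici (0 : ℝ), Real.exp (s * y) * (α / c * tail G y) = 1

/-- The exponentially tilted ladder height distribution
`F(dx) = e^{κ x} (α / c) (1 - G(x)) dx` on `[0, ∞)`. -/
def tiltedLadder (α c κ : ℝ) (G : Measure ℝ) : Measure ℝ :=
  (volume.restrict (Set.Ici (0 : ℝ))).withDensity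
    fun x => ENNReal.ofReal (Real.exp (κ * x) * (α / c * tail G x))

/-- The moment generating function `g(z) = ∫ e^{z x} F(dx)` of the tilted ladder height
distribution, for complex `z`. -/
def tiltedMGF (α c κ : ℝ) (G : Measure ℝ) (z : ℂ) : ℂ :=
  ∫ x : ℝ, Complex.exp (z * x) ∂(tiltedLadder α c κ G)

/-- The residue of `f` at an isolated singularity `w`: the common value of
`(2 π i)⁻¹ ∮_{|z - w| = ε} f(z) dz` for all small `ε > 0`. -/
def residue (f : ℂ → ℂ) (w : ℂ) : ℂ :=
  limUnder (𝓝[>] (0 : ℝ)) fun ε => (2 * Real.pi * Complex.I)⁻¹ * ∮ z in C(w, ε), f z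

/-- The term of the expansion that belongs to the root `w` of `g(z) = 1`, i.e. the residue at `w`
of `(α m - c) e^{-x (z + κ)} / (c (1 - g(z)) (z + κ))`, where `m` is the mean of `G`. -/
def expansionTerm (α c κ : ℝ) (G : Measure ℝ) (x : ℝ) (w : ℂ) : ℂ :=
  residue (fun z => (α * (∫ y, y ∂G : ℝ) - c) * Complex.exp (-x * (z + κ)) /
    (c * (1 - tiltedMGF α c κ G z) * (z + κ))) w

end RuinTheory

end

/-! Put `L = ladderMGF α c G`, so that `g(z) = L(z + κ)`, and `ρ = αm/c = L(0) < 1`. Capital grows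
between claims, so ruin can occur only at a claim, and `ψ(x)` is the probability that the random
walk with steps `Z k - c * T k` ever exceeds `x` (`ruinProb_eq_walkProb`). Conditioning on the first
step gives an integral equation for `ψ` and, by induction on the number of steps, Lundberg's bound
`ψ(x) ≤ e^{-κx}` (`isRuinFunction_walkProb`). From there on the argument is analytic and uses only
the properties collected in `IsRuinFunction`.

By the bound, `∫_0^∞ e^{wx} ψ(x) dx` converges for `Re w < κ`. For `0 ≤ Re w < κ` the integral
equation reads `w (1 - L(w)) ψ̂(w) = L(w) - ψ(0)`; taking `w = 0` forces `ψ(0) = ρ`, and for `0 < Re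
w < κ` this gives `ψ̂(w) = (1 - ρ) / (w (1 - L(w))) - 1 / w`, which continues meromorphically to the
whole plane. Fourier inversion on a line `0 < Re w = a < κ` recovers `ψ`; moving the line to `Re w =
b`, with `b` slightly larger than `r + κ`, picks up the residues at the roots of `L = 1` and leaves
a remainder `O(e^{-bx})` (`inversion`, `contour_shift`, `expansion`).

The decay this needs comes from `w L(w) = (α/c)(E e^{wZ} - 1)` (`mul_ladderMGF`), whose right side
is bounded on every half-plane `Re w ≤ b`. The transform itself decays only like `1/w`, because `ψ`
extended by zero jumps by `ρ` at the origin; subtracting `ρ e^{-Dx}` with `D > b` removes the jump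
and improves the decay to `1/(Im w)²`. The same identity bounds the roots in a half-plane, hence
their finiteness (`finite_roots`), and differentiated at a root it gives the second form of the
coefficients (`deriv_root`).

On the real line `L` is strictly increasing, so `κ` is unique. Since `|L(w)| ≤ L(Re w)`, every root
has `Re w ≥ κ`, with equality only at `κ`. For small `r` the expansion therefore has a single term,
whose constant is positive, and this is the Cramér–Lundberg asymptotics. -/

noncomputable section

namespace RuinTheory

/-! ### Residues -/

/-- All small circle integrals of `f` around `p` equal `2 π i A`. -/
def HasResidue (f : ℂ → ℂ) (p A : ℂ) : Prop :=
  ∀ᶠ ε in 𝓝[>] (0 : ℝ), CircleIntegrable f p ε ∧ (∮ z in C(p, ε), f z) = 2 * Real.pi * Complex.I * A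

theorem HasResidue.residue_eq {f : ℂ → ℂ} {p A : ℂ} (h : HasResidue f p A) : residue f p = A := by
  refine Tendsto.limUnder_eq ?_
  refine tendsto_const_nhds.congr' ?_
  filter_upwards [h] with ε hε
  rw [hε.2, inv_mul_cancel_left₀ Complex.two_pi_I_ne_zero]

theorem HasResidue.add {f g : ℂ → ℂ} {p A B : ℂ} (hf : HasResidue f p A) (hg : HasResidue g p B) :
    HasResidue (fun z => f z + g z) p (A + B) := by
  filter_upwards [hf, hg] with ε h1 h2
  refine ⟨h1.1.add h2.1, ?_⟩
  rw [circleIntegral.integral_add h1.1 h2.1, h1.2, h2.2]; ring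

theorem HasResidue.const_mul {f : ℂ → ℂ} {p A : ℂ} (hf : HasResidue f p A) (c : ℂ) :
    HasResidue (fun z => c * f z) p (c * A) := by
  filter_upwards [hf] with ε h1
  refine ⟨h1.1.const_smul (a := c), ?_⟩
  rw [circleIntegral.integral_const_mul, h1.2]; ring

theorem eventually_sphere {p : ℂ} {q : ℂ → Prop} (h : ∀ᶠ z in 𝓝[≠] p, q z) :
    ∀ᶠ ε in 𝓝[>] (0 : ℝ), ∀ z ∈ Metric.sphere p ε, q z := by
  rw [eventually_nhdsWithin_iff, Metric.eventually_nhds_iff] at h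
  obtain ⟨δ, hδ, h⟩ := h
  filter_upwards [Ioo_mem_nhdsGT hδ] with ε hε z hz
  refine h (by rw [Metric.mem_sphere.1 hz]; exact hε.2) ?_
  rintro rfl
  simp at hz
  exact hε.1.ne hz

theorem HasResidue.congr {f g : ℂ → ℂ} {p A : ℂ} (hf : HasResidue f p A)
    (hfg : ∀ᶠ z in 𝓝[≠] p, f z = g z) : HasResidue g p A := by
  filter_upwards [hf, eventually_sphere hfg, self_mem_nhdsWithin] with ε h1 h2 h3
  have h3' : (0 : ℝ) < ε := h3
  refine ⟨(circleIntegrable_congr ?_).1 h1.1, ?_⟩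
  · intro z hz
    rw [abs_of_pos h3'] at hz
    exact h2 z hz
  · rw [← h1.2]
    exact (circleIntegral.integral_congr h3'.le (fun z hz => h2 z hz)).symm

theorem hasResidue_of_analyticAt {f : ℂ → ℂ} {p : ℂ} (hf : AnalyticAt ℂ f p) :
    HasResidue f p 0 := by
  obtain ⟨δ, hδ, h⟩ := Metric.eventually_nhds_iff.1 hf.eventually_analyticAt
  filter_upwards [Ioo_mem_nhdsGT hδ] with ε hε
  have hd : DifferentiableOn ℂ f (Metric.closedBall p ε) := fun z hz =>
    (h (lt_of_le_of_lt (Metric.mem_closedBall.1 hz) hε.2)).differentiableAt.differentiableWithinAt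
  refine ⟨(hd.continuousOn.mono Metric.sphere_subset_closedBall).circleIntegrable hε.1.le, ?_⟩
  rw [mul_zero]
  exact Complex.circleIntegral_eq_zero_of_differentiable_on_off_countable hε.1.le
    Set.countable_empty hd.continuousOn
    (fun z hz => (h (lt_trans (Metric.mem_ball.1 hz.1) hε.2)).differentiableAt)

theorem hasResidue_sub_inv (p A : ℂ) : HasResidue (fun z => A * (z - p)⁻¹) p A := by
  filter_upwards [self_mem_nhdsWithin] with ε hε
  have hε' : (0 : ℝ) < ε := hε
  constructor
  · refine ContinuousOn.circleIntegrable hε'.le ?_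
    refine ContinuousOn.mul continuousOn_const (ContinuousOn.inv₀ (by fun_prop) ?_)
    intro z hz h0
    rw [sub_eq_zero.1 h0] at hz
    simp at hz
    exact hε'.ne hz
  · rw [circleIntegral.integral_const_mul, circleIntegral.integral_sub_center_inv _ hε'.ne']
    ring

theorem hasResidue_of_hasDerivAt {Q F : ℂ → ℂ} {p : ℂ} (hF : ∀ z, z ≠ p → HasDerivAt F (Q z) z)
    (hQ : ∀ z, z ≠ p → DifferentiableAt ℂ Q z) : HasResidue Q p 0 := by
  filter_upwards [self_mem_nhdsWithin] with ε hε
  have hε' : (0 : ℝ) < ε := hε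
  have hne : ∀ z ∈ Metric.sphere p ε, z ≠ p := by
    rintro z hz rfl
    simp at hz
    exact hε'.ne hz
  refine ⟨ContinuousOn.circleIntegrable hε'.le
    fun z hz => (hQ z (hne z hz)).continuousAt.continuousWithinAt, ?_⟩
  rw [mul_zero]
  exact circleIntegral.integral_eq_zero_of_hasDerivWithinAt hε'.le
    fun z hz => (hF z (hne z hz)).hasDerivWithinAt

/-- Induction on the order, peeling off `φ z = φ p + (z - p) * dslope φ p z`. Only the coefficient
of `(z - p)⁻¹` is kept explicit; the rest `Q` of the principal part has a primitive on the whole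
punctured plane, so it contributes nothing to any closed contour avoiding `p`, circle or rectangle.
-/
theorem exists_principalPart_of_analyticAt {p : ℂ} (n : ℕ) : ∀ {φ : ℂ → ℂ}, AnalyticAt ℂ φ p →
    ∃ (h Q F : ℂ → ℂ) (A : ℂ), AnalyticAt ℂ h p ∧ (∀ z, z ≠ p → HasDerivAt F (Q z) z) ∧
      (∀ z, z ≠ p → DifferentiableAt ℂ Q z) ∧
      ∀ z, z ≠ p → φ z * ((z - p) ^ n)⁻¹ = h z + (A * (z - p)⁻¹ + Q z) := by
  induction n with
  | zero =>
    intro φ hφ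
    exact ⟨φ, 0, 0, 0, hφ, fun z _ => hasDerivAt_const z 0, fun z _ => differentiableAt_const 0,
      fun z _ => by simp⟩
  | succ n ih =>
    intro φ hφ
    obtain ⟨q, hq⟩ := hφ
    have hd : AnalyticAt ℂ (dslope φ p) p := ⟨_, hq.has_fpower_series_dslope_fslope⟩
    obtain ⟨h, Q, F, A, hh, hF, hQ, he⟩ := ih hd
    have key : ∀ z, z ≠ p → φ z * ((z - p) ^ (n + 1))⁻¹ =
        h z + (A * (z - p)⁻¹ + Q z) + φ p * ((z - p) ^ (n + 1))⁻¹ := by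
      intro z hz
      have hz' : z - p ≠ 0 := sub_ne_zero.2 hz
      rw [← he z hz]
      have := sub_smul_dslope φ p z
      rw [smul_eq_mul] at this
      rw [← sub_eq_iff_eq_add, ← sub_mul, ← this, pow_succ]
      field_simp
    -- For `n = 0` the new term `φ p / (z - p)` has no primitive and joins `A`; otherwise it is a
    -- power of order at least two and joins `Q`.
    rcases Nat.eq_zero_or_pos n with rfl | hn
    · refine ⟨h, Q, F, A + φ p, hh, hF, hQ, fun z hz => ?_⟩
      rw [key z hz, zero_add, pow_one]; ring
    · refine ⟨h, fun z => Q z + φ p * ((z - p) ^ (n + 1))⁻¹,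
        fun z => F z + (-(φ p) / n) * ((z - p) ^ n)⁻¹, A, hh, fun z hz => ?_, fun z hz => ?_,
        fun z hz => ?_⟩
      · have hz' : z - p ≠ 0 := sub_ne_zero.2 hz
        refine (hF z hz).add ?_
        have h1 : HasDerivAt (fun z : ℂ => (z - p) ^ n) (n * (z - p) ^ (n - 1) * 1) z :=
          ((hasDerivAt_id z).sub_const p).pow n
        convert! (h1.inv (pow_ne_zero n hz')).const_mul (-(φ p) / n) using 1
        have hn' : (n : ℂ) ≠ 0 := by exact_mod_cast hn.ne'
        obtain ⟨m, rfl⟩ : ∃ m, n = m + 1 := ⟨n - 1, by omega⟩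
        simp only [Nat.add_sub_cancel]
        field_simp
        ring
      · have hz' : z - p ≠ 0 := sub_ne_zero.2 hz
        refine (hQ z hz).add (DifferentiableAt.const_mul (DifferentiableAt.inv (by fun_prop) ?_) _)
        exact pow_ne_zero _ hz'
      · rw [key z hz]; ring

theorem exists_principalPart_of_meromorphicAt {f : ℂ → ℂ} {p : ℂ} (hf : MeromorphicAt f p) :
    ∃ (h Q F : ℂ → ℂ) (A : ℂ), AnalyticAt ℂ h p ∧ (∀ z, z ≠ p → HasDerivAt F (Q z) z) ∧
      (∀ z, z ≠ p → DifferentiableAt ℂ Q z) ∧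
      ∀ᶠ z in 𝓝[≠] p, f z = h z + (A * (z - p)⁻¹ + Q z) := by
  obtain ⟨n, hn⟩ := hf
  obtain ⟨h, Q, F, A, hh, hF, hQ, he⟩ := exists_principalPart_of_analyticAt n hn
  refine ⟨h, Q, F, A, hh, hF, hQ, ?_⟩
  filter_upwards [self_mem_nhdsWithin] with z hz
  have hz' : z - p ≠ 0 := sub_ne_zero.2 hz
  rw [← he z hz, smul_eq_mul]
  field_simp

theorem exists_hasResidue_of_meromorphicAt {f : ℂ → ℂ} {p : ℂ} (hf : MeromorphicAt f p) :
    ∃ A, HasResidue f p A := by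
  obtain ⟨h, Q, F, A, hh, hF, hQ, he⟩ := exists_principalPart_of_meromorphicAt hf
  refine ⟨0 + (A + 0), ((hasResidue_of_analyticAt hh).add
    ((hasResidue_sub_inv p A).add (hasResidue_of_hasDerivAt hF hQ))).congr ?_⟩
  filter_upwards [he] with z hz using hz.symm

theorem hasResidue_residue {f : ℂ → ℂ} {p : ℂ} (hf : MeromorphicAt f p) :
    HasResidue f p (residue f p) := by
  obtain ⟨A, hA⟩ := exists_hasResidue_of_meromorphicAt hf
  rwa [hA.residue_eq]

/-- The residue at a simple pole. -/
theorem hasResidue_simple {φ : ℂ → ℂ} {p : ℂ} (hφ : AnalyticAt ℂ φ p) :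
    HasResidue (fun z => φ z * (z - p)⁻¹) p (φ p) := by
  obtain ⟨q, hq⟩ := hφ
  have hd : AnalyticAt ℂ (dslope φ p) p := ⟨_, hq.has_fpower_series_dslope_fslope⟩
  have := (hasResidue_of_analyticAt hd).add (hasResidue_sub_inv p (φ p))
  rw [zero_add] at this
  refine this.congr ?_
  filter_upwards [self_mem_nhdsWithin] with z hz
  have hz' : z - p ≠ 0 := sub_ne_zero.2 hz
  have h2 := sub_smul_dslope φ p z
  rw [smul_eq_mul] at h2
  field_simp
  linear_combination h2

/-- The residue of a quotient at a simple zero of the denominator. -/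
theorem hasResidue_div {φ q : ℂ → ℂ} {p : ℂ} (hφ : AnalyticAt ℂ φ p) (hq : AnalyticAt ℂ q p)
    (h0 : q p = 0) (h1 : deriv q p ≠ 0) :
    HasResidue (fun z => φ z / q z) p (φ p / deriv q p) := by
  obtain ⟨s, hs⟩ := hq
  have hd : AnalyticAt ℂ (dslope q p) p := ⟨_, hs.has_fpower_series_dslope_fslope⟩
  have hp : dslope q p p = deriv q p := dslope_same q p
  have := hasResidue_simple (hφ.div hd (by rwa [hp]))
  rw [Pi.div_apply, hp] at this
  refine this.congr ?_
  filter_upwards [self_mem_nhdsWithin] with z hz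
  have h2 := sub_smul_dslope q p z
  rw [smul_eq_mul, h0, sub_zero] at h2
  rw [Pi.div_apply, ← h2, div_mul_eq_div_div_swap, div_eq_mul_inv, div_eq_mul_inv]

/-! ### The residue theorem for rectangles -/

/-- The integral of `f` along the boundary of the rectangle `[a, b] × [-T, T]`. -/
def rectIntegral (f : ℂ → ℂ) (a b T : ℝ) : ℂ :=
  (∫ x : ℝ in a..b, f (x + (-T : ℝ) * Complex.I)) - (∫ x : ℝ in a..b, f (x + T * Complex.I)) +
    Complex.I * (∫ y : ℝ in (-T)..T, f (b + y * Complex.I)) -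
    Complex.I * (∫ y : ℝ in (-T)..T, f (a + y * Complex.I))

/-- The boundary of the rectangle `[a, b] × [-T, T]`. -/
def rectBoundary (a b T : ℝ) : Set ℂ :=
  {z | z.re ∈ Set.Icc a b ∧ z.im ∈ Set.Icc (-T) T ∧ (z.re = a ∨ z.re = b ∨ z.im = -T ∨ z.im = T)}

theorem horizontal_integral {f F : ℂ → ℂ} {a b y : ℝ} (hab : a ≤ b)
    (hF : ∀ x ∈ Set.Icc a b, HasDerivAt F (f (x + y * Complex.I)) (x + y * Complex.I))
    (hf : ContinuousOn (fun x : ℝ => f (x + y * Complex.I)) (Set.Icc a b)) :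
    ∫ x : ℝ in a..b, f (x + y * Complex.I) = F (b + y * Complex.I) - F (a + y * Complex.I) := by
  refine intervalIntegral.integral_eq_sub_of_hasDerivAt
    (f := fun x : ℝ => F (x + y * Complex.I)) (fun x hx => ?_) ?_
  · rw [Set.uIcc_of_le hab] at hx
    have h1 : HasDerivAt (fun x : ℂ => x + y * Complex.I) 1 (x : ℂ) :=
      (hasDerivAt_id _).add_const _
    have h2 : HasDerivAt (fun w : ℂ => F (w + y * Complex.I)) (f (x + y * Complex.I) * 1) (x : ℂ) :=
      HasDerivAt.comp (x : ℂ) (hF x hx) h1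
    simpa using h2.comp_ofReal
  · exact ContinuousOn.intervalIntegrable (by rwa [Set.uIcc_of_le hab])

theorem vertical_integral {f F : ℂ → ℂ} {x T : ℝ} (hT : 0 ≤ T)
    (hF : ∀ y ∈ Set.Icc (-T) T, HasDerivAt F (f (x + y * Complex.I)) (x + y * Complex.I))
    (hf : ContinuousOn (fun y : ℝ => f (x + y * Complex.I)) (Set.Icc (-T) T)) :
    Complex.I * ∫ y : ℝ in (-T)..T, f (x + y * Complex.I) =
      F (x + T * Complex.I) - F (x + (-T : ℝ) * Complex.I) := by
  have hle : -T ≤ T := by linarith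
  rw [← intervalIntegral.integral_const_mul]
  refine intervalIntegral.integral_eq_sub_of_hasDerivAt
    (f := fun y : ℝ => F (x + y * Complex.I)) (fun y hy => ?_) ?_
  · rw [Set.uIcc_of_le hle] at hy
    have h1 : HasDerivAt (fun w : ℂ => x + w * Complex.I) (1 * Complex.I) (y : ℂ) :=
      ((hasDerivAt_id (y : ℂ)).mul_const Complex.I).const_add (x : ℂ)
    have h2 : HasDerivAt (fun w : ℂ => F (x + w * Complex.I)) (f (x + y * Complex.I) * (1 * Complex.I))
        (y : ℂ) := HasDerivAt.comp (y : ℂ) (hF y hy) h1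
    convert! h2.comp_ofReal using 1
    ring
  · refine ContinuousOn.intervalIntegrable ?_
    rw [Set.uIcc_of_le hle]
    exact continuousOn_const.mul hf

section boundary
variable {a b T : ℝ}

theorem bottom_mem (hT : 0 ≤ T) {x : ℝ} (hx : x ∈ Set.Icc a b) :
    (x + (-T : ℝ) * Complex.I : ℂ) ∈ rectBoundary a b T := by
  refine ⟨by simpa using hx, ?_, ?_⟩ <;> simp [hT]

theorem top_mem (hT : 0 ≤ T) {x : ℝ} (hx : x ∈ Set.Icc a b) :
    (x + T * Complex.I : ℂ) ∈ rectBoundary a b T := by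
  refine ⟨by simpa using hx, ?_, ?_⟩ <;> simp [hT]

theorem right_mem (hab : a ≤ b) {y : ℝ} (hy : y ∈ Set.Icc (-T) T) :
    (b + y * Complex.I : ℂ) ∈ rectBoundary a b T := by
  refine ⟨by simpa using hab, by simpa using hy, by simp⟩

theorem left_mem (hab : a ≤ b) {y : ℝ} (hy : y ∈ Set.Icc (-T) T) :
    (a + y * Complex.I : ℂ) ∈ rectBoundary a b T := by
  refine ⟨by simpa using hab, by simpa using hy, by simp⟩

theorem ne_of_mem_rectBoundary {p z : ℂ} (hp : p.re ∈ Set.Ioo a b) (hp' : p.im ∈ Set.Ioo (-T) T)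
    (hz : z ∈ rectBoundary a b T) : z ≠ p := by
  rintro rfl
  obtain ⟨_, _, h | h | h | h⟩ := hz
  · exact hp.1.ne' h
  · exact hp.2.ne h
  · exact hp'.1.ne' h
  · exact hp'.2.ne h

theorem continuousOn_bottom {f : ℂ → ℂ} (hT : 0 ≤ T) (hf : ∀ z ∈ rectBoundary a b T, ContinuousAt f z) :
    ContinuousOn (fun x : ℝ => f (x + (-T : ℝ) * Complex.I)) (Set.Icc a b) := fun x hx =>
  (ContinuousAt.comp (f := fun x : ℝ => (x + (-T : ℝ) * Complex.I : ℂ)) (hf _ (bottom_mem hT hx))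
    (by fun_prop)).continuousWithinAt

theorem continuousOn_top {f : ℂ → ℂ} (hT : 0 ≤ T) (hf : ∀ z ∈ rectBoundary a b T, ContinuousAt f z) :
    ContinuousOn (fun x : ℝ => f (x + T * Complex.I)) (Set.Icc a b) := fun x hx =>
  (ContinuousAt.comp (f := fun x : ℝ => (x + T * Complex.I : ℂ)) (hf _ (top_mem hT hx))
    (by fun_prop)).continuousWithinAt

theorem continuousOn_right {f : ℂ → ℂ} (hab : a ≤ b) (hf : ∀ z ∈ rectBoundary a b T, ContinuousAt f z) :
    ContinuousOn (fun y : ℝ => f (b + y * Complex.I)) (Set.Icc (-T) T) := fun y hy =>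
  (ContinuousAt.comp (f := fun y : ℝ => (b + y * Complex.I : ℂ)) (hf _ (right_mem hab hy))
    (by fun_prop)).continuousWithinAt

theorem continuousOn_left {f : ℂ → ℂ} (hab : a ≤ b) (hf : ∀ z ∈ rectBoundary a b T, ContinuousAt f z) :
    ContinuousOn (fun y : ℝ => f (a + y * Complex.I)) (Set.Icc (-T) T) := fun y hy =>
  (ContinuousAt.comp (f := fun y : ℝ => (a + y * Complex.I : ℂ)) (hf _ (left_mem hab hy))
    (by fun_prop)).continuousWithinAt

theorem rectIntegral_add {f g : ℂ → ℂ} (hab : a ≤ b) (hT : 0 ≤ T)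
    (hf : ∀ z ∈ rectBoundary a b T, ContinuousAt f z)
    (hg : ∀ z ∈ rectBoundary a b T, ContinuousAt g z) :
    rectIntegral (fun z => f z + g z) a b T = rectIntegral f a b T + rectIntegral g a b T := by
  have hle : -T ≤ T := by linarith
  have e1 := intervalIntegral.integral_add (μ := volume)
    ((continuousOn_bottom hT hf).intervalIntegrable_of_Icc hab)
    ((continuousOn_bottom hT hg).intervalIntegrable_of_Icc hab)
  have e2 := intervalIntegral.integral_add (μ := volume)
    ((continuousOn_top hT hf).intervalIntegrable_of_Icc hab)
    ((continuousOn_top hT hg).intervalIntegrable_of_Icc hab)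
  have e3 := intervalIntegral.integral_add (μ := volume)
    ((continuousOn_right hab hf).intervalIntegrable_of_Icc hle)
    ((continuousOn_right hab hg).intervalIntegrable_of_Icc hle)
  have e4 := intervalIntegral.integral_add (μ := volume)
    ((continuousOn_left hab hf).intervalIntegrable_of_Icc hle)
    ((continuousOn_left hab hg).intervalIntegrable_of_Icc hle)
  unfold rectIntegral
  rw [e1, e2, e3, e4]
  ring

theorem rectIntegral_congr {f g : ℂ → ℂ} (hab : a ≤ b) (hT : 0 ≤ T)
    (hfg : ∀ z ∈ rectBoundary a b T, f z = g z) : rectIntegral f a b T = rectIntegral g a b T := by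
  have hle : -T ≤ T := by linarith
  unfold rectIntegral
  congr 1
  · congr 1
    · congr 1
      · refine intervalIntegral.integral_congr fun x hx => hfg _ (bottom_mem hT ?_)
        rwa [Set.uIcc_of_le hab] at hx
      · refine intervalIntegral.integral_congr fun x hx => hfg _ (top_mem hT ?_)
        rwa [Set.uIcc_of_le hab] at hx
    · congr 1
      refine intervalIntegral.integral_congr fun x hx => hfg _ (right_mem hab ?_)
      rwa [Set.uIcc_of_le hle] at hx
  · congr 1
    refine intervalIntegral.integral_congr fun x hx => hfg _ (left_mem hab ?_)
    rwa [Set.uIcc_of_le hle] at hx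

theorem rectIntegral_eq_zero_of_hasDerivAt {f F : ℂ → ℂ} (hab : a ≤ b) (hT : 0 ≤ T)
    (hF : ∀ z ∈ rectBoundary a b T, HasDerivAt F (f z) z)
    (hf : ∀ z ∈ rectBoundary a b T, ContinuousAt f z) : rectIntegral f a b T = 0 := by
  unfold rectIntegral
  rw [horizontal_integral hab (fun x hx => hF _ (bottom_mem hT hx)) (continuousOn_bottom hT hf),
    horizontal_integral hab (fun x hx => hF _ (top_mem hT hx)) (continuousOn_top hT hf),
    vertical_integral hT (fun x hx => hF _ (right_mem hab hx)) (continuousOn_right hab hf),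
    vertical_integral hT (fun x hx => hF _ (left_mem hab hx)) (continuousOn_left hab hf)]
  ring

theorem log_sub_log_neg {z : ℂ} (hz : 0 < z.im) :
    Complex.log z - Complex.log (-z) = Real.pi * Complex.I := by
  simp only [Complex.log, norm_neg, Complex.arg_neg_eq_arg_sub_pi_of_im_pos hz]
  push_cast; ring

theorem rectIntegral_sub_inv {p : ℂ} (A : ℂ) (hp : p.re ∈ Set.Ioo a b) (hp' : p.im ∈ Set.Ioo (-T) T) :
    rectIntegral (fun z => A * (z - p)⁻¹) a b T = 2 * Real.pi * Complex.I * A := by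
  have hab : a ≤ b := (hp.1.trans hp.2).le
  have hT : 0 ≤ T := by have := hp'.1.trans hp'.2; linarith
  have hc : ∀ z ∈ rectBoundary a b T, ContinuousAt (fun z => A * (z - p)⁻¹) z := fun z hz =>
    continuousAt_const.mul (ContinuousAt.inv₀ (by fun_prop)
      (sub_ne_zero.2 (ne_of_mem_rectBoundary hp hp' hz)))
  have hd : ∀ z : ℂ, z - p ∈ Complex.slitPlane →
      HasDerivAt (fun z => A * Complex.log (z - p)) (A * (z - p)⁻¹) z := fun z hz => by
    have h := (((hasDerivAt_id z).sub_const p).clog hz).const_mul A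
    simpa using h
  have hd' : ∀ z : ℂ, -(z - p) ∈ Complex.slitPlane →
      HasDerivAt (fun z => A * Complex.log (-(z - p))) (A * (z - p)⁻¹) z := fun z hz => by
    have h := (((hasDerivAt_id z).sub_const p).neg.clog hz).const_mul A
    exact h.congr_deriv (by
      rw [show (-fun x => id x - p) z = -(z - p) from rfl, neg_div_neg_eq, one_div])
  -- `log (z - p)` is a primitive on the bottom, top and right sides. The left side crosses its cut,
  -- so `log (-(z - p))` is used there; the two branches disagree at the two left corners, and each
  -- mismatch contributes `π i`.
  unfold rectIntegral
  rw [horizontal_integral (F := fun z => A * Complex.log (z - p)) hab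
      (fun x hx => hd _ (Or.inr ?_)) (continuousOn_bottom hT hc),
    horizontal_integral (F := fun z => A * Complex.log (z - p)) hab
      (fun x hx => hd _ (Or.inr ?_)) (continuousOn_top hT hc),
    vertical_integral (F := fun z => A * Complex.log (z - p)) hT
      (fun x hx => hd _ (Or.inl ?_)) (continuousOn_right hab hc),
    vertical_integral (F := fun z => A * Complex.log (-(z - p))) hT
      (fun x hx => hd' _ (Or.inl ?_)) (continuousOn_left hab hc)]
  · have h1 := log_sub_log_neg (z := a + T * Complex.I - p) (by simpa using hp'.2)
    have h2 := log_sub_log_neg (z := -(a + (-T : ℝ) * Complex.I - p)) (by simp; linarith [hp'.1])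
    rw [neg_neg] at h2
    linear_combination A * h1 + A * h2
  · simpa using hp.1
  · simpa using hp.2
  · simpa [sub_eq_zero] using hp'.2.ne'
  · simpa [sub_eq_zero] using hp'.1.ne

/-- The **residue theorem** for a rectangle. -/
theorem rectIntegral_eq_sum_residue (hab : a ≤ b) (hT : 0 ≤ T) (S : Finset ℂ) : ∀ f : ℂ → ℂ,
    (∀ p ∈ S, p.re ∈ Set.Ioo a b ∧ p.im ∈ Set.Ioo (-T) T) →
    (∀ p ∈ S, MeromorphicAt f p) →
    (∀ z : ℂ, z.re ∈ Set.Icc a b → z.im ∈ Set.Icc (-T) T → z ∉ S → DifferentiableAt ℂ f z) →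
    rectIntegral f a b T = 2 * Real.pi * Complex.I * ∑ p ∈ S, residue f p := by
  classical
  induction S using Finset.induction_on with
  | empty =>
    intro f _ _ hf
    have h := Complex.integral_boundary_rect_eq_zero_of_differentiableOn f
      (a + (-T : ℝ) * Complex.I) (b + T * Complex.I) ?_
    · simpa [rectIntegral] using h
    · intro z hz
      refine (hf z ?_ ?_ (by simp)).differentiableWithinAt
      · simpa [Set.uIcc_of_le hab] using hz.1
      · have := hz.2
        simpa [Set.uIcc_of_le (by linarith : -T ≤ T)] using this
  | insert p S hpS ih =>
    intro f hloc hmer hf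
    obtain ⟨h, Q, F, A, hh, hF, hQ, he⟩ :=
      exists_principalPart_of_meromorphicAt (hmer p (Finset.mem_insert_self p S))
    obtain ⟨hp, hp'⟩ := hloc p (Finset.mem_insert_self p S)
    set R : ℂ → ℂ := fun z => A * (z - p)⁻¹ + Q z with hR
    have hRd : ∀ z, z ≠ p → DifferentiableAt ℂ R z := fun z hz =>
      (((differentiableAt_id.sub_const p).inv (sub_ne_zero.2 hz)).const_mul A).add (hQ z hz)
    have hRan : ∀ z, z ≠ p → AnalyticAt ℂ R z := fun z hz =>
      Complex.analyticAt_iff_eventually_differentiableAt.2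
        ((isOpen_ne.eventually_mem hz).mono fun w hw => hRd w hw)
    -- Subtracting the principal part makes the singularity at `p` removable, and the updated value
    -- `h p` fills it in. As `R` is analytic away from `p`, the other residues do not change.
    set f₁ : ℂ → ℂ := Function.update (fun z => f z - R z) p (h p) with hf₁
    have hf₁ne : ∀ z, z ≠ p → f₁ z = f z - R z := fun z hz => by simp [hf₁, hz]
    have hf₁ev : ∀ z, z ≠ p → f₁ =ᶠ[𝓝 z] fun z => f z - R z := fun z hz =>
      (isOpen_ne.eventually_mem hz).mono fun w hw => hf₁ne w hw
    have hf₁p : f₁ =ᶠ[𝓝 p] h := by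
      rw [eventually_nhdsWithin_iff] at he
      filter_upwards [he] with z hz
      by_cases hzp : z = p
      · simp [hf₁, hzp]
      · rw [hf₁ne z hzp, hz hzp]; ring
    have hres : ∀ q ∈ S, residue f q = residue f₁ q := by
      intro q hq
      have hqp : q ≠ p := fun h => hpS (h ▸ hq)
      have hm : MeromorphicAt f₁ q :=
        ((hmer q (Finset.mem_insert_of_mem hq)).sub (hRan q hqp).meromorphicAt).congr
          ((hf₁ev q hqp).symm.filter_mono nhdsWithin_le_nhds)
      have := ((hasResidue_residue hm).add (hasResidue_of_analyticAt (hRan q hqp))).congr (g := f) ?_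
      · rw [this.residue_eq, add_zero]
      · filter_upwards [(hf₁ev q hqp).filter_mono nhdsWithin_le_nhds] with z hz
        rw [hz]; ring
    have hresp : residue f p = A := by
      have := ((hasResidue_of_analyticAt hh).add ((hasResidue_sub_inv p A).add
        (hasResidue_of_hasDerivAt hF hQ))).congr (g := f) (he.mono fun z hz => hz.symm)
      rw [this.residue_eq]; ring
    have ihf := ih f₁ (fun q hq => hloc q (Finset.mem_insert_of_mem hq)) (fun q hq => ?_)
      (fun z hz hz' hzS => ?_)
    · have hne : ∀ z ∈ rectBoundary a b T, z ≠ p := fun z hz => ne_of_mem_rectBoundary hp hp' hz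
      have hnS : ∀ z ∈ rectBoundary a b T, z ∉ S := fun z hz hzS =>
        ne_of_mem_rectBoundary (hloc z (Finset.mem_insert_of_mem hzS)).1
          (hloc z (Finset.mem_insert_of_mem hzS)).2 hz rfl
      have hfd : ∀ z ∈ rectBoundary a b T, DifferentiableAt ℂ f z := fun z hz =>
        hf z hz.1 hz.2.1 (by simp [hne z hz, hnS z hz])
      have hc1 : ∀ z ∈ rectBoundary a b T, ContinuousAt f₁ z := fun z hz =>
        (((hfd z hz).sub (hRd z (hne z hz))).congr_of_eventuallyEq (hf₁ev z (hne z hz))).continuousAt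
      rw [rectIntegral_congr hab hT (g := fun z => f₁ z + R z) (fun z hz => by
          rw [hf₁ne z (hne z hz)]; ring),
        rectIntegral_add hab hT hc1 (fun z hz => (hRd z (hne z hz)).continuousAt), ihf, hR,
        rectIntegral_add (f := fun z => A * (z - p)⁻¹) hab hT (fun z hz => continuousAt_const.mul
          (ContinuousAt.inv₀ (by fun_prop) (sub_ne_zero.2 (hne z hz)))) (fun z hz => (hQ z (hne z hz)).continuousAt),
        rectIntegral_sub_inv A hp hp', rectIntegral_eq_zero_of_hasDerivAt hab hT
          (fun z hz => hF z (hne z hz)) (fun z hz => (hQ z (hne z hz)).continuousAt),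
        Finset.sum_insert hpS, hresp, Finset.sum_congr rfl hres]
      ring
    · have hqp : q ≠ p := fun h => hpS (h ▸ hq)
      exact ((hmer q (Finset.mem_insert_of_mem hq)).sub (hRan q hqp).meromorphicAt).congr
        ((hf₁ev q hqp).symm.filter_mono nhdsWithin_le_nhds)
    · by_cases hzp : z = p
      · subst hzp
        exact hh.differentiableAt.congr_of_eventuallyEq hf₁p
      · exact ((hf z hz hz' (by simp [hzp, hzS])).sub (hRd z hzp)).congr_of_eventuallyEq
          (hf₁ev z hzp)

end boundary

/-! ### Shifting a vertical line of integration -/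

theorem integrable_vertical {f : ℂ → ℂ} {a C T₀ : ℝ}
    (hf : ∀ t : ℝ, ContinuousAt f (a + t * Complex.I))
    (hbd : ∀ t : ℝ, T₀ ≤ |t| → ‖f (a + t * Complex.I)‖ ≤ C / t ^ 2) :
    Integrable fun t : ℝ => f (a + t * Complex.I) := by
  have hc : Continuous fun t : ℝ => f (a + t * Complex.I) :=
    continuous_iff_continuousAt.2 fun t =>
      ContinuousAt.comp (f := fun t : ℝ => (a + t * Complex.I : ℂ)) (hf t) (by fun_prop)
  refine hc.locallyIntegrable.integrable_of_isBigO_cocompact (g := fun t : ℝ => (1 + t ^ 2)⁻¹) ?_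
    (integrable_inv_one_add_sq.integrableAtFilter _)
  refine IsBigO.of_bound (2 * |C|) ?_
  have h : ∀ᶠ t : ℝ in cocompact ℝ, max T₀ 1 ≤ ‖t‖ :=
    tendsto_norm_cocompact_atTop.eventually_ge_atTop _
  filter_upwards [h] with t ht
  rw [Real.norm_eq_abs] at ht
  have h1 : 1 ≤ |t| := (le_max_right _ _).trans ht
  have h2 : 1 ≤ t ^ 2 := by rw [← sq_abs]; nlinarith
  refine (hbd t ((le_max_left _ _).trans ht)).trans ?_
  rw [Real.norm_of_nonneg (by positivity), ← div_eq_mul_inv]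
  calc C / t ^ 2 ≤ |C| / t ^ 2 := by gcongr; exact le_abs_self C
    _ ≤ 2 * |C| / (1 + t ^ 2) := by
      rw [div_le_div_iff₀ (by positivity) (by positivity)]
      nlinarith [abs_nonneg C]

/-- The bound `C / (Im z)²` serves twice: it makes both vertical integrals absolutely convergent,
and it makes the horizontal sides of the rectangle vanish as its height grows. -/
theorem contour_shift {f : ℂ → ℂ} {a b C T₀ : ℝ} (hab : a ≤ b) (S : Finset ℂ)
    (hloc : ∀ p ∈ S, p.re ∈ Set.Ioo a b) (hmer : ∀ p ∈ S, MeromorphicAt f p)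
    (hf : ∀ z : ℂ, z.re ∈ Set.Icc a b → z ∉ S → DifferentiableAt ℂ f z)
    (hbd : ∀ z : ℂ, z.re ∈ Set.Icc a b → T₀ ≤ |z.im| → ‖f z‖ ≤ C / z.im ^ 2) :
    Integrable (fun t : ℝ => f (a + t * Complex.I)) ∧
    Integrable (fun t : ℝ => f (b + t * Complex.I)) ∧
    (∫ t : ℝ, f (a + t * Complex.I)) =
      (∫ t : ℝ, f (b + t * Complex.I)) - 2 * Real.pi * ∑ p ∈ S, residue f p := by
  have hline : ∀ σ, σ = a ∨ σ = b → Integrable (fun t : ℝ => f (σ + t * Complex.I)) := by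
    intro σ hσ
    have hmem : σ ∈ Set.Icc a b := by rcases hσ with rfl | rfl <;> simp [hab]
    refine integrable_vertical (C := C) (T₀ := T₀) (fun t => (hf _ (by simpa using hmem)
      fun hS => ?_).continuousAt) (fun t ht => ?_)
    · have := hloc _ hS
      rw [show (σ + t * Complex.I : ℂ).re = σ by simp] at this
      rcases hσ with rfl | rfl
      · exact lt_irrefl _ this.1
      · exact lt_irrefl _ this.2
    · have := hbd (σ + t * Complex.I) (by simpa using hmem) (by simpa using ht)
      simpa using this
  have ha := hline a (Or.inl rfl)
  have hb := hline b (Or.inr rfl)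
  refine ⟨ha, hb, ?_⟩
  have hhor : ∀ e : ℝ → ℝ, (∀ T, |e T| = |T|) →
      Tendsto (fun T : ℝ => ∫ x : ℝ in a..b, f (x + e T * Complex.I)) atTop (𝓝 0) := by
    intro e he
    have hlim : Tendsto (fun T : ℝ => C / T ^ 2 * |b - a|) atTop (𝓝 0) := by
      have h0 : Tendsto (fun T : ℝ => C / T ^ 2) atTop (𝓝 0) :=
        tendsto_const_nhds.div_atTop (tendsto_pow_atTop (by norm_num))
      simpa using h0.mul_const |b - a|
    refine squeeze_zero_norm' ?_ hlim
    filter_upwards [eventually_ge_atTop (max T₀ 0)] with T hT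
    have hT0 : 0 ≤ T := (le_max_right _ _).trans hT
    refine intervalIntegral.norm_integral_le_of_norm_le_const fun x hx => ?_
    rw [Set.uIoc_of_le hab] at hx
    have := hbd (x + e T * Complex.I) (by simpa using ⟨hx.1.le, hx.2⟩)
      (by simpa [he, abs_of_nonneg hT0] using (le_max_left _ _).trans hT)
    refine this.trans (le_of_eq ?_)
    have : e T ^ 2 = T ^ 2 := by rw [← sq_abs, he, sq_abs]
    simp [this]
  have hvert : ∀ σ : ℝ, Integrable (fun t : ℝ => f (σ + t * Complex.I)) →
      Tendsto (fun T : ℝ => ∫ y : ℝ in (-T)..T, f (σ + y * Complex.I)) atTop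
        (𝓝 (∫ t : ℝ, f (σ + t * Complex.I))) := fun σ hσ =>
    intervalIntegral_tendsto_integral hσ tendsto_neg_atTop_atBot tendsto_id
  have hlim : Tendsto (fun T => rectIntegral f a b T) atTop
      (𝓝 (0 - 0 + Complex.I * (∫ t : ℝ, f (b + t * Complex.I)) -
        Complex.I * ∫ t : ℝ, f (a + t * Complex.I))) := by
    have h1 := hhor (fun T => -T) (fun T => abs_neg T)
    have h2 := hhor (fun T => T) (fun T => rfl)
    exact ((h1.sub h2).add ((hvert b hb).const_mul _)).sub ((hvert a ha).const_mul _)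
  have hconst : Tendsto (fun T => rectIntegral f a b T) atTop
      (𝓝 (2 * Real.pi * Complex.I * ∑ p ∈ S, residue f p)) := by
    refine tendsto_const_nhds.congr' ?_
    -- The poles are finitely many, so all tall enough rectangles contain all of them and the
    -- contour integral is eventually constant.
    obtain ⟨K, hK⟩ : ∃ K, ∀ p ∈ S, |p.im| ≤ K :=
      (S.finite_toSet.image fun p : ℂ => |p.im|).bddAbove.imp fun K hK p hp =>
        hK ⟨p, hp, rfl⟩
    filter_upwards [eventually_gt_atTop (max K 0)] with T hT
    have hT0 : 0 ≤ T := (le_max_right _ _).trans hT.le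
    refine (rectIntegral_eq_sum_residue hab hT0 S f (fun p hp => ⟨hloc p hp, ?_⟩) hmer
      (fun z hz _ hzS => hf z hz hzS)).symm
    exact abs_lt.1 (((hK p hp).trans (le_max_left _ _)).trans_lt hT)
  have := tendsto_nhds_unique hlim hconst
  have hI : Complex.I ≠ 0 := Complex.I_ne_zero
  apply mul_left_cancel₀ hI
  linear_combination -this

/-! ### The claim size distribution and the ladder height distribution -/

/-- Light-tailed nonnegative claims, not concentrated at `0`, with positive safety loading. -/
structure IsClaimModel (α c : ℝ) (G : Measure ℝ) : Prop where
  α_pos : 0 < α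
  c_pos : 0 < c
  isProb : IsProbabilityMeasure G
  nonneg : G (Set.Iio 0) = 0
  ne_dirac : G ≠ Measure.dirac 0
  integrable_exp_pos : ∀ s : ℝ, 0 < s → Integrable (fun y => Real.exp (s * y)) G
  safe : 0 < c - α * ∫ y, y ∂G

/-- The moment generating function of the ladder height (sub-probability) distribution. -/
def ladderMGF (α c : ℝ) (G : Measure ℝ) : ℂ → ℂ := complexMGF id (tiltedLadder α c 0 G)

theorem tail_nonneg (G : Measure ℝ) (y : ℝ) : 0 ≤ tail G y := measureReal_nonneg

theorem tail_antitone (G : Measure ℝ) [IsFiniteMeasure G] : Antitone (tail G) := fun _ _ h =>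
  measureReal_mono (Set.Ioi_subset_Ioi h)

theorem measurable_tail (G : Measure ℝ) [IsFiniteMeasure G] : Measurable (tail G) :=
  (tail_antitone G).measurable

theorem lintegral_density_lt_top {f : ℝ → ℝ} {μ : Measure ℝ} :
    ∀ᵐ x ∂μ, ENNReal.ofReal (f x) < ⊤ := Eventually.of_forall fun _ => ENNReal.ofReal_lt_top

theorem setIntegral_Ici_indicator {E : Type*} [NormedAddCommGroup E] [NormedSpace ℝ E]
    (h : ℝ → E) {z : ℝ} (hz : 0 ≤ z) :
    ∫ y in Set.Ici (0 : ℝ), (if y < z then h y else 0) = ∫ y in (0 : ℝ)..z, h y := by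
  have : (fun y => if y < z then h y else 0) = (Set.Iio z).indicator h := by
    ext y; simp [Set.indicator_apply]
  rw [this, setIntegral_indicator measurableSet_Iio, Set.Ici_inter_Iio,
    intervalIntegral.integral_of_le hz, integral_Ico_eq_integral_Ioo, integral_Ioc_eq_integral_Ioo]

theorem integrableOn_Ici_indicator {E : Type*} [NormedAddCommGroup E]
    {h : ℝ → E} (hh : Continuous h) (z : ℝ) :
    IntegrableOn (fun y => if y < z then h y else 0) (Set.Ici 0) := by
  have : (fun y => if y < z then h y else 0) = (Set.Iio z).indicator h := by
    ext y; simp [Set.indicator_apply]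
  rw [this, IntegrableOn, integrable_indicator_iff measurableSet_Iio, IntegrableOn,
    Measure.restrict_restrict measurableSet_Iio, Set.inter_comm, Set.Ici_inter_Iio]
  exact (hh.integrableOn_Icc (a := 0) (b := z)).mono_set Set.Ico_subset_Icc_self

/-- Integrability over the triangle `0 ≤ y < z`. -/
theorem integrable_triangle {μ : Measure ℝ} [SFinite μ] {k : ℝ → ℂ} {D : ℝ → ℝ} {v : ℂ}
    (hμ : ∀ᵐ z ∂μ, 0 ≤ z) (hk : Measurable k) (hD : Integrable D μ)
    (hkD : ∀ z, 0 ≤ z → (∫ y in (0 : ℝ)..z, Real.exp (v.re * y)) * ‖k z‖ ≤ D z) :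
    Integrable (Function.uncurry fun (y z : ℝ) => if y < z then Complex.exp (v * y) * k z else 0)
      ((volume.restrict (Set.Ici (0 : ℝ))).prod μ) := by
  have hm : Measurable
      (Function.uncurry fun (y z : ℝ) => if y < z then Complex.exp (v * y) * k z else 0) :=
    Measurable.ite (measurableSet_lt measurable_fst measurable_snd) (by fun_prop) measurable_const
  rw [integrable_prod_iff' hm.aestronglyMeasurable]
  constructor
  · refine Eventually.of_forall fun z => ?_
    exact integrableOn_Ici_indicator (h := fun y : ℝ => Complex.exp (v * y) * k z) (by fun_prop) z
  · refine hD.mono' ?_ ?_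
    · exact (hm.norm.stronglyMeasurable.integral_prod_left'
        (μ := volume.restrict (Set.Ici 0))).aestronglyMeasurable
    · filter_upwards [hμ] with z hz
      have e : ∀ y : ℝ, ‖Function.uncurry
          (fun (y z : ℝ) => if y < z then Complex.exp (v * y) * k z else 0) (y, z)‖
          = if y < z then Real.exp (v.re * y) * ‖k z‖ else 0 := by
        intro y
        simp only [Function.uncurry]
        split_ifs
        · rw [norm_mul, Complex.norm_exp]; simp
        · simp
      simp_rw [e]
      rw [setIntegral_Ici_indicator _ hz, intervalIntegral.integral_mul_const, Real.norm_of_nonneg]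
      · exact hkD z hz
      · exact mul_nonneg (intervalIntegral.integral_nonneg hz fun y _ => (Real.exp_pos _).le)
          (norm_nonneg _)

/-- Fubini on the triangle. With `μ = G` and `k = 1` it evaluates integrals of the tail; with `μ`
Lebesgue measure on the half-line it transforms the integral equation of the ruin probability. -/
theorem integral_triangle {μ : Measure ℝ} [SFinite μ] {k : ℝ → ℂ} {D : ℝ → ℝ} {v : ℂ}
    (hμ : ∀ᵐ z ∂μ, 0 ≤ z) (hk : Measurable k) (hD : Integrable D μ)
    (hkD : ∀ z, 0 ≤ z → (∫ y in (0 : ℝ)..z, Real.exp (v.re * y)) * ‖k z‖ ≤ D z) :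
    ∫ y in Set.Ici (0 : ℝ), (∫ z, (if y < z then Complex.exp (v * y) * k z else 0) ∂μ) =
      ∫ z, (∫ y in (0 : ℝ)..z, Complex.exp (v * y)) * k z ∂μ := by
  rw [integral_integral_swap (integrable_triangle hμ hk hD hkD)]
  refine integral_congr_ae ?_
  filter_upwards [hμ] with z hz
  rw [setIntegral_Ici_indicator (fun y : ℝ => Complex.exp (v * y) * k z) hz,
    intervalIntegral.integral_mul_const]

/-- The integrand is at most `e^{|s| z}` and the length `z` is at most `e^z`. The crude exponent
avoids a case distinction at `s = 0` and is harmless because all exponential moments of the claims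
are finite. -/
theorem integral_exp_le {s z : ℝ} (hz : 0 ≤ z) :
    ∫ y in (0 : ℝ)..z, Real.exp (s * y) ≤ Real.exp ((|s| + 1) * z) := by
  have hle : ∀ y ∈ Set.uIoc 0 z, ‖Real.exp (s * y)‖ ≤ Real.exp (|s| * z) := by
    intro y hy
    rw [Set.uIoc_of_le hz] at hy
    rw [Real.norm_eq_abs, Real.abs_exp]
    gcongr
    · exact hy.1.le
    · exact le_abs_self _
    · exact hy.2
  refine (le_abs_self _).trans ((intervalIntegral.norm_integral_le_of_norm_le_const hle).trans ?_)
  rw [sub_zero, abs_of_nonneg hz, add_mul, Real.exp_add, one_mul]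
  gcongr
  linarith [Real.add_one_le_exp z]

namespace IsClaimModel

variable {α c : ℝ} {G : Measure ℝ} (H : IsClaimModel α c G)
include H

theorem ae_nonneg : ∀ᵐ y ∂G, 0 ≤ y := by
  rw [ae_iff]
  convert H.nonneg using 2
  ext y; simp

theorem integrable_exp (s : ℝ) : Integrable (fun y => Real.exp (s * y)) G := by
  have := H.isProb
  rcases lt_or_ge 0 s with hs | hs
  · exact H.integrable_exp_pos s hs
  · refine (integrable_const (1 : ℝ)).mono' (by fun_prop) ?_
    filter_upwards [H.ae_nonneg] with y hy
    rw [Real.norm_eq_abs, Real.abs_exp, Real.exp_le_one_iff]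
    exact mul_nonpos_of_nonpos_of_nonneg hs hy

theorem integrableExpSet_claim : integrableExpSet id G = Set.univ :=
  Set.eq_univ_of_forall fun s => H.integrable_exp s

theorem norm_claimMGF_le {b : ℝ} {w : ℂ} (hw : w.re ≤ b) : ‖complexMGF id G w‖ ≤ mgf id G b := by
  refine norm_complexMGF_le_mgf.trans ?_
  refine integral_mono_ae (H.integrable_exp _) (H.integrable_exp _) ?_
  filter_upwards [H.ae_nonneg] with y hy
  simp only [id]
  gcongr

omit H in
theorem integral_tail_indicator [IsFiniteMeasure G] (h : ℂ) (y : ℝ) :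
    ∫ z, (if y < z then h else 0) ∂G = h * tail G y := by
  have : (fun z => if y < z then h else 0) = (Set.Ioi y).indicator fun _ => h := by
    ext z; simp [Set.indicator_apply]
  rw [this, integral_indicator measurableSet_Ioi, setIntegral_const, tail, mul_comm]
  simp

theorem integrableOn_exp_mul_tail (w : ℂ) :
    IntegrableOn (fun y : ℝ => Complex.exp (w * y) * tail G y) (Set.Ici 0) := by
  have := H.isProb
  have := (integrable_triangle (k := fun _ => 1) (v := w) H.ae_nonneg measurable_const
    (H.integrable_exp (|w.re| + 1)) (fun z hz => by simpa using integral_exp_le hz)).integral_prod_left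
  simp only [Function.uncurry, mul_one, integral_tail_indicator] at this
  exact this

theorem integral_exp_mul_tail (w : ℂ) :
    ∫ y in Set.Ici (0 : ℝ), Complex.exp (w * y) * tail G y =
      ∫ z, (∫ y in (0 : ℝ)..z, Complex.exp (w * y)) ∂G := by
  have := H.isProb
  have := integral_triangle (k := fun _ => 1) (v := w) H.ae_nonneg measurable_const
    (H.integrable_exp (|w.re| + 1)) (fun z hz => by simpa using integral_exp_le hz)
  simpa only [mul_one, integral_tail_indicator] using this

theorem integrableOn_real (s : ℝ) :
    IntegrableOn (fun y : ℝ => Real.exp (s * y) * (α / c * tail G y)) (Set.Ici 0) := by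
  have h := ((H.integrableOn_exp_mul_tail s).const_mul ((α / c : ℝ) : ℂ)).re
  refine h.congr (Eventually.of_forall fun y => ?_)
  have : ((α / c : ℝ) : ℂ) * (Complex.exp (s * y) * tail G y) =
    ((Real.exp (s * y) * (α / c * tail G y) : ℝ) : ℂ) := by push_cast; ring
  simp only [this]
  exact Complex.ofReal_re _

theorem density_nonneg (s y : ℝ) : 0 ≤ Real.exp (s * y) * (α / c * tail G y) := by
  have h1 := H.α_pos
  have h2 := H.c_pos
  have h3 := tail_nonneg G y
  positivity

theorem measurable_density (s : ℝ) :
    Measurable fun y : ℝ => ENNReal.ofReal (Real.exp (s * y) * (α / c * tail G y)) := by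
  have := H.isProb
  have := measurable_tail G
  fun_prop

theorem integral_tiltedLadder {E : Type*} [NormedAddCommGroup E] [NormedSpace ℝ E] (s : ℝ)
    (φ : ℝ → E) : ∫ y, φ y ∂(tiltedLadder α c s G) =
      ∫ y in Set.Ici (0 : ℝ), (Real.exp (s * y) * (α / c * tail G y)) • φ y := by
  rw [tiltedLadder, integral_withDensity_eq_integral_toReal_smul (H.measurable_density s)
    lintegral_density_lt_top]
  simp only [ENNReal.toReal_ofReal (H.density_nonneg s _)]

theorem integrableExpSet_ladder : integrableExpSet id (tiltedLadder α c 0 G) = Set.univ := by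
  refine Set.eq_univ_of_forall fun s => ?_
  change Integrable (fun y => Real.exp (s * id y)) (tiltedLadder α c 0 G)
  rw [tiltedLadder, integrable_withDensity_iff_integrable_smul' (H.measurable_density 0)
    lintegral_density_lt_top]
  refine (H.integrableOn_real s).congr (Eventually.of_forall fun y => ?_)
  beta_reduce
  rw [ENNReal.toReal_ofReal (H.density_nonneg 0 _)]
  simp only [id, smul_eq_mul, zero_mul, Real.exp_zero]
  ring

theorem ladderMGF_eq (w : ℂ) :
    ladderMGF α c G w = α / c * ∫ y in Set.Ici (0 : ℝ), Complex.exp (w * y) * tail G y := by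
  rw [ladderMGF, complexMGF, H.integral_tiltedLadder, ← integral_const_mul]
  congr 1
  ext y
  simp only [zero_mul, Real.exp_zero, one_mul, id, Complex.real_smul]
  push_cast; ring

theorem tiltedMGF_eq (κ : ℝ) (z : ℂ) : tiltedMGF α c κ G z = ladderMGF α c G (z + κ) := by
  rw [tiltedMGF, H.integral_tiltedLadder, H.ladderMGF_eq, ← integral_const_mul]
  congr 1
  ext y
  rw [Complex.real_smul, add_mul, Complex.exp_add]
  push_cast; ring

omit H in
theorem ladderMGF_ofReal (s : ℝ) :
    ladderMGF α c G s = (mgf id (tiltedLadder α c 0 G) s : ℂ) := complexMGF_ofReal s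

theorem lundbergEq_iff (s : ℝ) : LundbergEq α c G s ↔ mgf id (tiltedLadder α c 0 G) s = 1 := by
  rw [LundbergEq, mgf, H.integral_tiltedLadder]
  simp only [zero_mul, Real.exp_zero, one_mul, id, smul_eq_mul]
  simp only [mul_comm]

/-- Fubini turns the tail integral into the `G`-mean of `∫_0^z e^{wy} dy = (e^{wz} - 1) / w`. This
identity is the source of the decay of `ladderMGF` in the imaginary direction. -/
theorem mul_ladderMGF (w : ℂ) :
    w * ladderMGF α c G w = α / c * (complexMGF id G w - 1) := by
  have := H.isProb
  rcases eq_or_ne w 0 with rfl | hw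
  · simp [complexMGF]
  have hM : Integrable (fun z : ℝ => Complex.exp (w * z)) G := by
    rw [← integrable_norm_iff (by fun_prop)]
    simpa [Complex.norm_exp] using H.integrable_exp w.re
  rw [H.ladderMGF_eq, H.integral_exp_mul_tail]
  simp only [integral_exp_mul_complex hw]
  rw [integral_div, Complex.ofReal_zero, mul_zero, Complex.exp_zero,
    integral_sub hM (integrable_const _), complexMGF]
  simp only [integral_const, probReal_univ, one_smul, id]
  field_simp

theorem ladderMGF_zero : ladderMGF α c G 0 = (α / c * ∫ y, y ∂G : ℝ) := by
  rw [H.ladderMGF_eq, H.integral_exp_mul_tail]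
  simp only [zero_mul, Complex.exp_zero, intervalIntegral.integral_const, sub_zero,
    Complex.real_smul, mul_one]
  rw [integral_complex_ofReal]
  push_cast; rfl

theorem mgf_ladder_zero : mgf id (tiltedLadder α c 0 G) 0 = α / c * ∫ y, y ∂G := by
  have h := H.ladderMGF_zero
  rw [← Complex.ofReal_zero, ladderMGF_ofReal] at h
  exact_mod_cast h

theorem mean_pos : 0 < ∫ y, y ∂G := by
  have := H.isProb
  have hint : Integrable (fun y : ℝ => y) G := by
    have := integrable_pow_of_mem_interior_integrableExpSet (X := id) (μ := G)
      (by simp [H.integrableExpSet_claim]) 1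
    simpa using this
  rw [integral_pos_iff_support_of_nonneg_ae H.ae_nonneg hint, pos_iff_ne_zero]
  intro h0
  refine H.ne_dirac ?_
  have hae : (fun y : ℝ => y) =ᵐ[G] fun _ => 0 := by
    rw [Filter.EventuallyEq, ae_iff]
    exact h0
  calc G = G.map id := Measure.map_id.symm
    _ = G.map fun _ => 0 := Measure.map_congr hae
    _ = Measure.dirac 0 := by rw [Measure.map_const, measure_univ, one_smul]

theorem rho_pos : 0 < α / c * ∫ y, y ∂G := mul_pos (div_pos H.α_pos H.c_pos) H.mean_pos

theorem rho_lt_one : α / c * ∫ y, y ∂G < 1 := by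
  rw [div_mul_eq_mul_div, div_lt_one H.c_pos]
  linarith [H.safe]

theorem ladder_ne_zero : tiltedLadder α c 0 G ≠ 0 := by
  intro h
  have h1 := H.mgf_ladder_zero
  rw [h] at h1
  rw [mgf_zero_measure, Pi.zero_apply] at h1
  exact H.rho_pos.ne h1

omit H in
theorem ladder_absolutelyContinuous : tiltedLadder α c 0 G ≪ volume :=
  (withDensity_absolutelyContinuous _ _).trans Measure.absolutelyContinuous_restrict

omit H in
theorem ae_ladder_pos : ∀ᵐ y ∂(tiltedLadder α c 0 G), 0 < y := by
  have h1 : ∀ᵐ y ∂(volume.restrict (Set.Ici (0 : ℝ))), 0 < y := by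
    rw [← restrict_Ioi_eq_restrict_Ici]
    exact ae_restrict_mem measurableSet_Ioi
  exact (withDensity_absolutelyContinuous _ _).ae_le h1

theorem integrable_mul_exp_ladder (s : ℝ) :
    Integrable (fun y => y * Real.exp (s * y)) (tiltedLadder α c 0 G) := by
  have := integrable_pow_mul_exp_of_mem_interior_integrableExpSet (X := id) (v := s)
    (μ := tiltedLadder α c 0 G) (by simp [H.integrableExpSet_ladder]) 1
  simpa using this

theorem integrable_exp_ladder (s : ℝ) :
    Integrable (fun y => Real.exp (s * y)) (tiltedLadder α c 0 G) := by
  have h : s ∈ integrableExpSet id (tiltedLadder α c 0 G) := by simp [H.integrableExpSet_ladder]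
  exact h

theorem integral_mul_exp_ladder_pos (s : ℝ) :
    0 < ∫ y, y * Real.exp (s * y) ∂(tiltedLadder α c 0 G) := by
  rw [integral_pos_iff_support_of_nonneg_ae _ (H.integrable_mul_exp_ladder s), pos_iff_ne_zero]
  · intro h0
    have : ∀ᵐ y ∂(tiltedLadder α c 0 G), False := by
      have h1 : ∀ᵐ y ∂(tiltedLadder α c 0 G), y * Real.exp (s * y) = 0 := by
        rw [ae_iff]; exact h0
      filter_upwards [h1, ae_ladder_pos] with y hy hy'
      exact (mul_pos hy' (Real.exp_pos _)).ne' hy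
    rw [eventually_false_iff_eq_bot, ae_eq_bot] at this
    exact H.ladder_ne_zero this
  · filter_upwards [ae_ladder_pos] with y hy
    exact (mul_pos hy (Real.exp_pos _)).le

/-- The tangent inequality of a convex function: `e^u ≥ 1 + u` with `u = (t - s) y`, multiplied by
`e^{sy}` and integrated. It gives both strict monotonicity and an explicit point where the value
exceeds one. -/
theorem mgf_ladder_ge (s t : ℝ) :
    mgf id (tiltedLadder α c 0 G) s + (t - s) * ∫ y, y * Real.exp (s * y) ∂(tiltedLadder α c 0 G) ≤
      mgf id (tiltedLadder α c 0 G) t := by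
  change ∫ y, Real.exp (s * y) ∂_ + _ ≤ ∫ y, Real.exp (t * y) ∂_
  rw [← integral_const_mul, ← integral_add (H.integrable_exp_ladder s)
    ((H.integrable_mul_exp_ladder s).const_mul _)]
  refine integral_mono ((H.integrable_exp_ladder s).add ((H.integrable_mul_exp_ladder s).const_mul _))
    (H.integrable_exp_ladder t) fun y => ?_
  have h := Real.add_one_le_exp ((t - s) * y)
  have h2 : Real.exp (t * y) = Real.exp (s * y) * Real.exp ((t - s) * y) := by
    rw [← Real.exp_add]; ring_nf
  simp only [h2]
  nlinarith [Real.exp_pos (s * y)]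

theorem strictMono_mgf_ladder : StrictMono (mgf id (tiltedLadder α c 0 G)) := fun s t hst => by
  have h1 := H.mgf_ladder_ge s t
  have h2 := mul_pos (sub_pos.2 hst) (H.integral_mul_exp_ladder_pos s)
  linarith

theorem differentiable_ladderMGF : Differentiable ℂ (ladderMGF α c G) := fun w =>
  (hasDerivAt_complexMGF (by simp [H.integrableExpSet_ladder])).differentiableAt

theorem continuous_mgf_ladder : Continuous (mgf id (tiltedLadder α c 0 G)) :=
  continuous_iff_continuousAt.2 fun _ =>
    (hasDerivAt_mgf (by simp [H.integrableExpSet_ladder])).continuousAt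

theorem exists_adjustment : ∃ κ : ℝ, 0 < κ ∧ mgf id (tiltedLadder α c 0 G) κ = 1 := by
  set I := ∫ y, y * Real.exp (0 * y) ∂(tiltedLadder α c 0 G) with hI
  have hIpos : 0 < I := H.integral_mul_exp_ladder_pos 0
  have h0 : mgf id (tiltedLadder α c 0 G) 0 < 1 := H.mgf_ladder_zero.trans_lt H.rho_lt_one
  have h0' : 0 < mgf id (tiltedLadder α c 0 G) 0 := H.rho_pos.trans_eq H.mgf_ladder_zero.symm
  -- The tangent at `0` has slope `I > 0`, so at `1 / I` it has risen by exactly one above the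
  -- positive value at `0`; the intermediate value theorem applies on `[0, 1 / I]`.
  have h1 := H.mgf_ladder_ge 0 (1 / I)
  rw [← hI, sub_zero, one_div, inv_mul_cancel₀ hIpos.ne'] at h1
  obtain ⟨κ, hκ, hκ1⟩ := intermediate_value_Icc (f := mgf id (tiltedLadder α c 0 G))
    (a := 0) (b := I⁻¹) (by positivity) H.continuous_mgf_ladder.continuousOn
    ⟨h0.le, by linarith⟩
  refine ⟨κ, lt_of_le_of_ne hκ.1 ?_, hκ1⟩
  rintro rfl
  linarith

omit H in
theorem norm_ladderMGF_le (w : ℂ) : ‖ladderMGF α c G w‖ ≤ mgf id (tiltedLadder α c 0 G) w.re :=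
  norm_complexMGF_le_mgf

theorem norm_mul_ladderMGF_le {b : ℝ} {w : ℂ} (hw : w.re ≤ b) :
    ‖w * ladderMGF α c G w‖ ≤ α / c * (mgf id G b + 1) := by
  have h1 : 0 < α / c := div_pos H.α_pos H.c_pos
  have h2 : ‖((α : ℂ) / c)‖ = α / c := by
    rw [← Complex.ofReal_div, Complex.norm_real, Real.norm_of_nonneg h1.le]
  rw [H.mul_ladderMGF, norm_mul, h2]
  gcongr
  refine (norm_sub_le _ _).trans ?_
  rw [norm_one]
  gcongr
  exact H.norm_claimMGF_le hw

/-- Differentiate both sides of `mul_ladderMGF` and use that the factor `ladderMGF` equals one at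
the root. -/
theorem deriv_root {w : ℂ} (hw : ladderMGF α c G w = 1) :
    c * deriv (ladderMGF α c G) w * w = α * (∫ y : ℝ, y * Complex.exp (w * y) ∂G) - c := by
  have hc : (c : ℂ) ≠ 0 := by exact_mod_cast H.c_pos.ne'
  have h1 : HasDerivAt (fun w => w * ladderMGF α c G w)
      (1 * ladderMGF α c G w + w * deriv (ladderMGF α c G) w) w :=
    (hasDerivAt_id w).mul (H.differentiable_ladderMGF w).hasDerivAt
  have h2 : HasDerivAt (fun w => w * ladderMGF α c G w)
      (α / c * (∫ y : ℝ, y * Complex.exp (w * y) ∂G)) w := by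
    have : (fun w => w * ladderMGF α c G w) = fun w => α / c * (complexMGF id G w - 1) :=
      funext H.mul_ladderMGF
    rw [this]
    exact ((hasDerivAt_complexMGF (X := id) (μ := G)
      (by simp [H.integrableExpSet_claim])).sub_const 1).const_mul _
  have h3 := h1.unique h2
  rw [hw] at h3
  field_simp at h3
  linear_combination h3

theorem norm_root_le {R : ℝ} {w : ℂ} (hw : ladderMGF α c G w = 1) (hR : w.re ≤ R) :
    ‖w‖ ≤ α / c * (mgf id G R + 1) := by
  simpa [hw] using H.norm_mul_ladderMGF_le hR

/-- At a root `‖w‖ = ‖w L(w)‖` is bounded, so infinitely many roots would accumulate; the identity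
theorem would then make `L` constantly one, against `L(0) = ρ < 1`. -/
theorem finite_roots (R : ℝ) : {w : ℂ | w.re ≤ R ∧ ladderMGF α c G w = 1}.Finite := by
  by_contra hinf
  obtain ⟨p, -, hp⟩ := Set.Infinite.exists_accPt_of_subset_isCompact hinf
    (isCompact_closedBall (0 : ℂ) (α / c * (mgf id G R + 1)))
    (fun w hw => by simpa using H.norm_root_le hw.2 hw.1)
  have hfr : ∃ᶠ z in 𝓝[≠] p, ladderMGF α c G z = 1 := by
    rw [accPt_iff_frequently_nhdsNE] at hp
    exact hp.mono fun z hz => hz.2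
  have := AnalyticOnNhd.eq_of_frequently_eq
    (Complex.analyticOnNhd_univ_iff_differentiable.2 H.differentiable_ladderMGF)
    (analyticOnNhd_const (v := (1 : ℂ))) hfr
  have h0 := congrFun this 0
  rw [H.ladderMGF_zero] at h0
  exact H.rho_lt_one.ne (by exact_mod_cast h0)

/-! ### Location of the roots -/

section roots

variable {κ : ℝ} (hκ : mgf id (tiltedLadder α c 0 G) κ = 1)
include hκ

theorem le_re_of_root {w : ℂ} (hw : ladderMGF α c G w = 1) : κ ≤ w.re := by
  have h := norm_ladderMGF_le (α := α) (c := c) (G := G) w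
  rw [hw, norm_one, ← hκ] at h
  exact H.strictMono_mgf_ladder.le_iff_le.1 h

/-- The equality case of `|L(w)| ≤ L(Re w)`. The real part of the equation says that the nonnegative
function `e^{κy} (1 - cos (Im w · y))` has integral zero, so the cosine is one almost everywhere. If
`Im w ≠ 0` this holds only on a countable set, which is null because the ladder measure has a
density. -/
theorem root_eq_of_re_le {w : ℂ} (hw : ladderMGF α c G w = 1) (hre : w.re ≤ κ) : w = κ := by
  have hre' : w.re = κ := le_antisymm hre (H.le_re_of_root hκ hw)
  refine Complex.ext (by simpa using hre') ?_
  rw [Complex.ofReal_im]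
  by_contra him
  have hint : Integrable (fun y : ℝ => Complex.exp (w * y)) (tiltedLadder α c 0 G) := by
    rw [← integrable_norm_iff (by fun_prop)]
    simpa [Complex.norm_exp] using H.integrable_exp_ladder w.re
  have hre1 : ∫ y, Real.exp (κ * y) * Real.cos (w.im * y) ∂(tiltedLadder α c 0 G) = 1 := by
    have h := integral_re hint
    have h2 : ∫ y : ℝ, Complex.exp (w * y) ∂(tiltedLadder α c 0 G) = 1 := hw
    rw [h2] at h
    simpa [Complex.exp_re, hre'] using h
  have hI : Integrable (fun y => Real.exp (κ * y) * Real.cos (w.im * y)) (tiltedLadder α c 0 G) := by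
    have h := hint.re
    refine h.congr (Eventually.of_forall fun y => ?_)
    simp [Complex.exp_re, hre']
  have hzero : ∫ y, (Real.exp (κ * y) - Real.exp (κ * y) * Real.cos (w.im * y))
      ∂(tiltedLadder α c 0 G) = 0 := by
    rw [integral_sub (H.integrable_exp_ladder κ) hI, hre1, sub_eq_zero]
    exact hκ
  replace hzero := (integral_eq_zero_iff_of_nonneg_ae (Eventually.of_forall fun y => ?_)
    ((H.integrable_exp_ladder κ).sub hI)).1 hzero
  · have hcount : (Set.range fun n : ℤ => n * (2 * Real.pi) / w.im).Countable :=
      Set.countable_range _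
    have hnull := hcount.ae_notMem (volume : Measure ℝ)
    have : ∀ᵐ y ∂(tiltedLadder α c 0 G), False := by
      filter_upwards [hzero, ladder_absolutelyContinuous.ae_le hnull] with y hy hy'
      have hcos : Real.cos (w.im * y) = 1 := by
        have h1 := Real.exp_pos (κ * y)
        simp only [Pi.zero_apply, Pi.sub_apply] at hy
        have h2 : Real.exp (κ * y) * (1 - Real.cos (w.im * y)) = 0 := by linarith
        rcases mul_eq_zero.1 h2 with h3 | h3
        · exact absurd h3 h1.ne'
        · linarith
      obtain ⟨n, hn⟩ := (Real.cos_eq_one_iff _).1 hcos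
      exact hy' ⟨n, by simp only [hn]; field_simp⟩
    rw [eventually_false_iff_eq_bot, ae_eq_bot] at this
    exact H.ladder_ne_zero this
  · have := Real.cos_le_one (w.im * y)
    have := Real.exp_pos (κ * y)
    simp only [Pi.zero_apply, Pi.sub_apply]
    nlinarith

theorem isProbabilityMeasure_tiltedLadder : IsProbabilityMeasure (tiltedLadder α c κ G) := by
  constructor
  rw [tiltedLadder, withDensity_apply _ MeasurableSet.univ, Measure.restrict_univ,
    ← ofReal_integral_eq_lintegral_ofReal (H.integrableOn_real κ)
      (Eventually.of_forall fun y => H.density_nonneg κ y)]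
  rw [← ENNReal.ofReal_one, (H.lundbergEq_iff κ).2 hκ]

end roots

end IsClaimModel

/-! ### The transform of the ruin probability -/

/-- The analytic description of the ruin probability: the Lundberg bound and the equation obtained
by conditioning on the first claim. -/
structure IsRuinFunction (α c κ : ℝ) (G : Measure ℝ) (ψ : ℝ → ℝ) : Prop where
  antitone : Antitone ψ
  nonneg : ∀ x, 0 ≤ ψ x
  eq_one : ∀ x, x < 0 → ψ x = 1
  le_exp : ∀ x, ψ x ≤ Real.exp (-κ * x)
  step : ∀ x, 0 ≤ x → ψ x =
    α / c * Real.exp (α / c * x) * ∫ s in Set.Ioi x, Real.exp (-(α / c) * s) * ∫ z, ψ (s - z) ∂G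

/-- The Laplace transform of `ψ`. -/
def ruinTransform (ψ : ℝ → ℝ) (w : ℂ) : ℂ := ∫ x in Set.Ici (0 : ℝ), Complex.exp (w * x) * ψ x

theorem integrableOn_exp_Ici {a : ℝ} (ha : a < 0) :
    IntegrableOn (fun x => Real.exp (a * x)) (Set.Ici 0) := by
  rw [integrableOn_Ici_iff_integrableOn_Ioi]
  exact integrableOn_exp_mul_Ioi ha 0

namespace IsRuinFunction

variable {α c κ : ℝ} {G : Measure ℝ} {ψ : ℝ → ℝ} (h : IsRuinFunction α c κ G ψ)
include h

theorem measurable : Measurable ψ := h.antitone.measurable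

theorem norm_exp_mul_le (w : ℂ) (x : ℝ) :
    ‖Complex.exp (w * x) * ψ x‖ ≤ Real.exp ((w.re - κ) * x) := by
  rw [norm_mul, Complex.norm_exp, Complex.norm_real, Real.norm_of_nonneg (h.nonneg x)]
  calc _ ≤ Real.exp (w * x).re * Real.exp (-κ * x) := by gcongr; exact h.le_exp x
    _ = _ := by rw [← Real.exp_add]; simp; ring

theorem integrableOn {w : ℂ} (hw : w.re < κ) :
    IntegrableOn (fun x : ℝ => Complex.exp (w * x) * ψ x) (Set.Ici 0) := by
  have := h.measurable
  refine (integrableOn_exp_Ici (a := w.re - κ) (by linarith)).mono' (by fun_prop) ?_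
  exact Eventually.of_forall fun x => h.norm_exp_mul_le w x

variable (H : IsClaimModel α c G)
include H

theorem measurable_claim : Measurable fun s => ∫ z, ψ (s - z) ∂G := by
  have := H.isProb
  have hm : Measurable (Function.uncurry fun s z => ψ (s - z)) :=
    h.measurable.comp (measurable_fst.sub measurable_snd)
  exact hm.stronglyMeasurable.integral_prod_right.measurable

omit H in
theorem claim_nonneg (s : ℝ) : 0 ≤ ∫ z, ψ (s - z) ∂G := integral_nonneg fun _ => h.nonneg _

theorem claim_le (s : ℝ) : ∫ z, ψ (s - z) ∂G ≤ mgf id G κ * Real.exp (-κ * s) := by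
  rw [mgf, ← integral_mul_const]
  refine integral_mono_of_nonneg (Eventually.of_forall fun z => h.nonneg _)
    ((H.integrable_exp κ).mul_const _) (Eventually.of_forall fun z => ?_)
  refine (h.le_exp (s - z)).trans (le_of_eq ?_)
  simp only [id]
  rw [← Real.exp_add]; ring_nf

-- A claim larger than the capital `s` ruins at once, so `ψ (s - z) = 1` for `s < z`; the part `s ≥
-- z` is a translate of the transform.
omit H in
theorem integral_shift {w : ℂ} (hw : w.re < κ) {z : ℝ} (hz : 0 ≤ z) :
    ∫ s in Set.Ici (0 : ℝ), Complex.exp (w * s) * ψ (s - z) =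
      (∫ y in (0 : ℝ)..z, Complex.exp (w * y)) + Complex.exp (w * z) * ruinTransform ψ w := by
  have hsplit : ∀ s ∈ Set.Ici (0 : ℝ), Complex.exp (w * s) * ψ (s - z) =
      (if s < z then Complex.exp (w * s) else 0) +
        (Set.Ici z).indicator (fun s : ℝ => Complex.exp (w * z) *
          (Complex.exp (w * (s - z : ℝ)) * ψ (s - z))) s := by
    intro s _
    by_cases hs : s < z
    · rw [if_pos hs, h.eq_one _ (by linarith), Set.indicator_of_notMem (by simpa using hs)]
      simp
    · rw [if_neg hs, Set.indicator_of_mem (by simpa using hs), zero_add, ← mul_assoc,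
        ← Complex.exp_add]
      congr 2
      push_cast; ring
  have hcomp : ∀ s : ℝ, (Set.Ici z).indicator (fun s : ℝ => Complex.exp (w * z) *
          (Complex.exp (w * (s - z : ℝ)) * ψ (s - z))) s =
      Complex.exp (w * z) * (Set.Ici (0 : ℝ)).indicator
        (fun u : ℝ => Complex.exp (w * u) * ψ u) (s - z) := by
    intro s
    simp only [Set.indicator_apply, Set.mem_Ici, sub_nonneg]
    split_ifs <;> simp
  have hi : Integrable ((Set.Ici (0 : ℝ)).indicator fun u : ℝ => Complex.exp (w * u) * ψ u) :=
    (integrable_indicator_iff measurableSet_Ici).2 (h.integrableOn hw)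
  have hI2 : Integrable ((Set.Ici z).indicator (fun s : ℝ => Complex.exp (w * z) *
          (Complex.exp (w * (s - z : ℝ)) * ψ (s - z)))) := by
    rw [funext hcomp]
    exact (hi.comp_sub_right z).const_mul _
  rw [setIntegral_congr_fun measurableSet_Ici hsplit, integral_add
    (integrableOn_Ici_indicator (h := fun s : ℝ => Complex.exp (w * s)) (by fun_prop) z)
    hI2.integrableOn, setIntegral_Ici_indicator (fun s : ℝ => Complex.exp (w * s)) hz]
  congr 1
  rw [setIntegral_indicator measurableSet_Ici, Set.inter_eq_self_of_subset_right
    (Set.Ici_subset_Ici.2 hz), ← integral_indicator measurableSet_Ici, funext hcomp,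
    integral_const_mul, integral_sub_right_eq_self
      ((Set.Ici (0 : ℝ)).indicator fun u : ℝ => Complex.exp (w * u) * ψ u) z,
    integral_indicator measurableSet_Ici, ruinTransform]

theorem integral_claim {w : ℂ} (hw : w.re < κ) :
    ∫ s in Set.Ici (0 : ℝ), Complex.exp (w * s) * (∫ z, ψ (s - z) ∂G : ℝ) =
      (∫ z, (∫ y in (0 : ℝ)..z, Complex.exp (w * y)) ∂G) + complexMGF id G w * ruinTransform ψ w := by
  have := H.isProb
  have hm : Measurable (Function.uncurry fun (s z : ℝ) => Complex.exp (w * s) * ψ (s - z)) := by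
    have hm' : Measurable fun p : ℝ × ℝ => ψ (p.1 - p.2) :=
      h.measurable.comp (measurable_fst.sub measurable_snd)
    exact (by fun_prop : Measurable fun p : ℝ × ℝ => Complex.exp (w * p.1)).mul
      (Complex.measurable_ofReal.comp hm')
  have hint : Integrable (Function.uncurry fun (s z : ℝ) => Complex.exp (w * s) * ψ (s - z))
      ((volume.restrict (Set.Ici (0 : ℝ))).prod G) := by
    refine ((integrableOn_exp_Ici (a := w.re - κ) (by linarith)).mul_prod
      (H.integrable_exp κ)).mono' hm.aestronglyMeasurable (Eventually.of_forall fun p => ?_)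
    simp only [Function.uncurry]
    rw [norm_mul, Complex.norm_exp, Complex.norm_real, Real.norm_of_nonneg (h.nonneg _)]
    calc _ ≤ Real.exp (w * p.1).re * Real.exp (-κ * (p.1 - p.2)) := by gcongr; exact h.le_exp _
      _ = _ := by rw [← Real.exp_add, ← Real.exp_add]; simp; ring
  have hM : Integrable (fun z : ℝ => Complex.exp (w * z)) G := by
    rw [← integrable_norm_iff (by fun_prop)]
    simpa [Complex.norm_exp] using H.integrable_exp w.re
  have hI : Integrable (fun z : ℝ => ∫ y in (0 : ℝ)..z, Complex.exp (w * y)) G := by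
    refine ((integrable_triangle (k := fun _ => 1) (v := w) H.ae_nonneg measurable_const
      (H.integrable_exp (|w.re| + 1))
      (fun z hz => by simpa using integral_exp_le hz)).integral_prod_right).congr ?_
    filter_upwards [H.ae_nonneg] with z hz
    simpa only [Function.uncurry, mul_one] using
      setIntegral_Ici_indicator (fun y : ℝ => Complex.exp (w * y)) hz
  have e : ∀ s : ℝ, Complex.exp (w * s) * (∫ z, ψ (s - z) ∂G : ℝ) =
      ∫ z, Complex.exp (w * s) * ψ (s - z) ∂G := fun s => by
    rw [integral_const_mul, integral_complex_ofReal]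
  simp only [e]
  rw [integral_integral_swap hint]
  calc _ = ∫ z, ((∫ y in (0 : ℝ)..z, Complex.exp (w * y)) +
        Complex.exp (w * z) * ruinTransform ψ w) ∂G := by
        refine integral_congr_ae ?_
        filter_upwards [H.ae_nonneg] with z hz using h.integral_shift hw hz
    _ = _ := by
        rw [integral_add hI (hM.mul_const _), integral_mul_const]
        rfl

theorem integrableOn_exp_mul_claim {w : ℂ} (hw : w.re < κ) :
    IntegrableOn (fun s : ℝ => Complex.exp (w * s) * (∫ z, ψ (s - z) ∂G : ℝ)) (Set.Ici 0) := by
  have := h.measurable_claim H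
  refine ((integrableOn_exp_Ici (a := w.re - κ) (by linarith)).const_mul (mgf id G κ)).mono'
    (by fun_prop) (Eventually.of_forall fun s => ?_)
  rw [norm_mul, Complex.norm_exp, Complex.norm_real, Real.norm_of_nonneg (h.claim_nonneg s)]
  calc _ ≤ Real.exp (w * s).re * (mgf id G κ * Real.exp (-κ * s)) := by
        gcongr; exact h.claim_le H s
    _ = _ := by
      rw [mul_left_comm, ← Real.exp_add]; simp; left; ring

/-- Insert the integral equation for `ψ` and exchange the integrals: the inner one becomes `∫_0^s
e^{(w + β) y} dy`, whose upper limit gives the transform of the claim average and whose lower limit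
gives `ψ 0`. -/
theorem transform_eq_aux {w : ℂ} (hw0 : 0 ≤ w.re) (hw : w.re < κ) :
    (w + α / c) * ruinTransform ψ w =
      α / c * (∫ s in Set.Ici (0 : ℝ), Complex.exp (w * s) * (∫ z, ψ (s - z) ∂G : ℝ)) - ψ 0 := by
  set β : ℝ := α / c with hβ
  have hβpos : 0 < β := div_pos H.α_pos H.c_pos
  have hβ' : (α / c : ℂ) = (β : ℂ) := by rw [hβ]; push_cast; rfl
  set B : ℝ → ℝ := fun s => ∫ z, ψ (s - z) ∂G with hB
  have hBm : Measurable B := h.measurable_claim H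
  have hne : w + β ≠ 0 := fun h0 => by
    have := congrArg Complex.re h0
    simp at this
    linarith
  have hmem : ∀ᵐ z ∂(volume.restrict (Set.Ici (0 : ℝ))), 0 ≤ z := ae_restrict_mem measurableSet_Ici
  -- Since `Re w ≥ 0`, the inner integral is at most `β⁻¹ e^{(Re w + β) z}`. The factors `β` and
  -- `e^{βz}` cancel, and Lundberg's bound leaves the integrable `e^{(Re w - κ) z}`.
  have hD : ∀ z : ℝ, 0 ≤ z → (∫ y in (0 : ℝ)..z, Real.exp ((w + β).re * y)) *
      ‖(β : ℂ) * (Complex.exp (-β * z) * B z)‖ ≤ mgf id G κ * Real.exp ((w.re - κ) * z) := by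
    intro z hz
    have hre : (w + β).re = w.re + β := by simp
    have hpos : 0 < w.re + β := by linarith
    rw [hre, norm_mul, norm_mul, Complex.norm_exp, Complex.norm_real, Complex.norm_real,
      Real.norm_of_nonneg hβpos.le, Real.norm_of_nonneg (h.claim_nonneg z),
      intervalIntegral.integral_comp_mul_left (fun y => Real.exp y) hpos.ne', integral_exp]
    have h1 : (-(β : ℂ) * z).re = -β * z := by simp
    rw [h1, mul_zero, Real.exp_zero, smul_eq_mul]
    have h2 : (w.re + β)⁻¹ * (Real.exp ((w.re + β) * z) - 1) ≤
        β⁻¹ * Real.exp ((w.re + β) * z) := by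
      have : (w.re + β)⁻¹ ≤ β⁻¹ := inv_anti₀ hβpos (by linarith)
      have h3 : 1 ≤ Real.exp ((w.re + β) * z) := Real.one_le_exp (by positivity)
      gcongr
      linarith
    calc _ ≤ β⁻¹ * Real.exp ((w.re + β) * z) *
          (β * (Real.exp (-β * z) * (mgf id G κ * Real.exp (-κ * z)))) := by
          gcongr
          · exact mul_nonneg hβpos.le (mul_nonneg (Real.exp_pos _).le (h.claim_nonneg z))
          · exact h.claim_le H z
      _ = mgf id G κ * (Real.exp ((w.re + β) * z) * Real.exp (-β * z) * Real.exp (-κ * z)) := by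
          field_simp
      _ = _ := by
          rw [← Real.exp_add, ← Real.exp_add]; ring_nf
  have key := integral_triangle (μ := volume.restrict (Set.Ici (0 : ℝ))) (v := w + β)
    (k := fun z => (β : ℂ) * (Complex.exp (-β * z) * B z)) hmem (by fun_prop)
    ((integrableOn_exp_Ici (a := w.re - κ) (by linarith)).const_mul (mgf id G κ)) hD
  have hL : ∀ y ∈ Set.Ici (0 : ℝ), (∫ z in Set.Ici (0 : ℝ), (if y < z then
      Complex.exp ((w + β) * y) * ((β : ℂ) * (Complex.exp (-β * z) * B z)) else 0)) =
      Complex.exp (w * y) * ψ y := by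
    intro y hy
    have hy : 0 ≤ y := hy
    have e1 : (fun z : ℝ => if y < z then
        Complex.exp ((w + β) * y) * ((β : ℂ) * (Complex.exp (-β * z) * B z)) else 0) =
        (Set.Ioi y).indicator fun z : ℝ => Complex.exp ((w + β) * y) * β *
          ((Real.exp (-β * z) * B z : ℝ) : ℂ) := by
      ext z
      simp only [Set.indicator_apply, Set.mem_Ioi]
      split_ifs
      · push_cast; ring
      · rfl
    rw [e1, setIntegral_indicator measurableSet_Ioi, Set.inter_eq_self_of_subset_right
      (Set.Ioi_subset_Ici hy), integral_const_mul, integral_complex_ofReal,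
      h.step y hy, ← hβ, add_mul, Complex.exp_add]
    push_cast
    ring
  rw [setIntegral_congr_fun measurableSet_Ici hL] at key
  have hψ0 : (ψ 0 : ℂ) = β * ∫ s in Set.Ici (0 : ℝ), Complex.exp ((-β : ℂ) * s) * B s := by
    rw [h.step 0 le_rfl, mul_zero, Real.exp_zero, mul_one, ← hβ, integral_Ici_eq_integral_Ioi]
    push_cast
    rw [← integral_complex_ofReal]
    push_cast
    rfl
  rw [hβ', hψ0, ruinTransform, key, ← mul_sub, ← integral_sub (h.integrableOn_exp_mul_claim H hw)
    (h.integrableOn_exp_mul_claim H (by simp; linarith)), ← integral_const_mul, ← integral_const_mul]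
  congr 1
  ext s
  have he : Complex.exp ((w + β) * s) * Complex.exp (-β * s) = Complex.exp (w * s) := by
    rw [← Complex.exp_add]; ring_nf
  rw [integral_exp_mul_complex hne, Complex.ofReal_zero, mul_zero, Complex.exp_zero, ← mul_assoc,
    mul_div_cancel₀ _ hne, ← he]
  ring

theorem transform_eq {w : ℂ} (hw0 : 0 ≤ w.re) (hw : w.re < κ) :
    w * (1 - ladderMGF α c G w) * ruinTransform ψ w = ladderMGF α c G w - ψ 0 := by
  have h1 := h.transform_eq_aux H hw0 hw
  rw [h.integral_claim H hw, ← H.integral_exp_mul_tail, mul_add, ← H.ladderMGF_eq] at h1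
  have h2 := H.mul_ladderMGF w
  linear_combination h1 - h2 * ruinTransform ψ w

/-- The transform is finite at `w = 0` because `κ > 0`, so the left side of `transform_eq` vanishes
there. -/
theorem zero_eq (hκ : 0 < κ) : ψ 0 = α / c * ∫ y, y ∂G := by
  have h1 := h.transform_eq H (w := 0) le_rfl hκ
  rw [zero_mul, zero_mul, H.ladderMGF_zero, eq_comm, sub_eq_zero] at h1
  exact_mod_cast h1.symm

theorem ruinTransform_eq (hκ : mgf id (tiltedLadder α c 0 G) κ = 1) {w : ℂ} (hw0 : 0 < w.re)
    (hw : w.re < κ) : ruinTransform ψ w =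
      (1 - α / c * ∫ y, y ∂G : ℝ) / (w * (1 - ladderMGF α c G w)) - 1 / w := by
  have h1 := h.transform_eq H hw0.le hw
  rw [h.zero_eq H (hw0.trans hw)] at h1
  have hw' : w ≠ 0 := by rintro rfl; simp at hw0
  have hL : 1 - ladderMGF α c G w ≠ 0 := fun h0 =>
    hw.not_ge (H.le_re_of_root hκ (sub_eq_zero.1 h0).symm)
  field_simp
  push_cast at h1 ⊢
  linear_combination h1

/-- On the positive half-line the integral equation writes `ψ` as an exponential times a constant
minus a primitive of an integrable function. Continuity is what makes Fourier inversion hold at the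
point itself. -/
theorem continuousAt {x : ℝ} (hx : 0 < x) (hκ : 0 < κ) : ContinuousAt ψ x := by
  set β : ℝ := α / c with hβ
  have hβpos : 0 < β := div_pos H.α_pos H.c_pos
  have hm := h.measurable_claim H
  have hint : IntegrableOn (fun s => Real.exp (-β * s) * ∫ z, ψ (s - z) ∂G) (Set.Ici 0) := by
    have h1 := (h.integrableOn_exp_mul_claim H (w := (-β : ℝ)) (by simp; linarith)).re
    refine h1.congr (Eventually.of_forall fun s => ?_)
    beta_reduce
    rw [← Complex.ofReal_mul, ← Complex.ofReal_exp, ← Complex.ofReal_mul]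
    exact Complex.ofReal_re _
  have hint' : ∀ y, 0 ≤ y → ∫ s in Set.Ioi y, Real.exp (-β * s) * ∫ z, ψ (s - z) ∂G =
      (∫ s in Set.Ioi 0, Real.exp (-β * s) * ∫ z, ψ (s - z) ∂G) -
        ∫ s in (0 : ℝ)..y, Real.exp (-β * s) * ∫ z, ψ (s - z) ∂G := by
    intro y hy
    rw [eq_sub_iff_add_eq', intervalIntegral.integral_interval_add_Ioi
      (hint.mono_set Set.Ioi_subset_Ici_self)
      (hint.mono_set (fun s hs => hy.trans (le_of_lt hs)))]
  have heq : ψ =ᶠ[𝓝 x] fun y => β * Real.exp (β * y) *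
      ((∫ s in Set.Ioi 0, Real.exp (-β * s) * ∫ z, ψ (s - z) ∂G) -
        ∫ s in (0 : ℝ)..y, Real.exp (-β * s) * ∫ z, ψ (s - z) ∂G) := by
    filter_upwards [lt_mem_nhds hx] with y hy
    rw [← hint' y hy.le]
    exact h.step y hy.le
  refine ContinuousAt.congr ?_ heq.symm
  refine ContinuousAt.mul (by fun_prop) (continuousAt_const.sub ?_)
  have hc := intervalIntegral.continuousOn_primitive_interval (μ := volume) (a := 0) (b := x + 1)
    (f := fun s => Real.exp (-β * s) * ∫ z, ψ (s - z) ∂G)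
    (hint.mono_set (by rw [Set.uIcc_of_le (by linarith)]; exact Set.Icc_subset_Ici_self))
  refine hc.continuousAt ?_
  rw [Set.uIcc_of_le (by linarith)]
  exact Icc_mem_nhds hx (by linarith)

end IsRuinFunction

/-! ### Inversion of the transform -/

/-- The transform of `ψ(x) - ρ e^{-D x}`, continued meromorphically. -/
def contTransform (α c : ℝ) (G : Measure ℝ) (D : ℝ) (w : ℂ) : ℂ :=
  (1 - α / c * ∫ y, y ∂G : ℝ) / (w * (1 - ladderMGF α c G w)) - 1 / w +
    (α / c * ∫ y, y ∂G : ℝ) / (w - D)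

/-- The function whose residues are the terms of the expansion. -/
def residueKernel (α c : ℝ) (G : Measure ℝ) (x : ℝ) (w : ℂ) : ℂ :=
  -((1 - α / c * ∫ y, y ∂G : ℝ) * Complex.exp (-x * w)) / (w * (1 - ladderMGF α c G w))

namespace IsClaimModel

variable {α c : ℝ} {G : Measure ℝ} (H : IsClaimModel α c G)
include H

theorem differentiableAt_contTransform {D : ℝ} {w : ℂ} (hw : w ≠ 0) (hD : w ≠ D)
    (hL : ladderMGF α c G w ≠ 1) : DifferentiableAt ℂ (contTransform α c G D) w := by
  have h1 := H.differentiable_ladderMGF w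
  have h2 : w * (1 - ladderMGF α c G w) ≠ 0 := mul_ne_zero hw (sub_ne_zero.2 hL.symm)
  have h3 : w - D ≠ 0 := sub_ne_zero.2 hD
  exact (((differentiableAt_const _).div (differentiableAt_id.mul (h1.const_sub 1)) h2).sub
    ((differentiableAt_const _).div differentiableAt_id hw)).add
    ((differentiableAt_const _).div (differentiableAt_id.sub_const _) h3)

theorem meromorphicAt_contTransform (D : ℝ) (w : ℂ) :
    MeromorphicAt (contTransform α c G D) w := by
  have h1 : MeromorphicAt (ladderMGF α c G) w := (H.differentiable_ladderMGF.analyticAt w).meromorphicAt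
  have h2 : MeromorphicAt (fun w : ℂ => w) w := MeromorphicAt.id w
  exact (((MeromorphicAt.const _ w).div (h2.mul ((MeromorphicAt.const 1 w).sub h1))).sub
    ((MeromorphicAt.const 1 w).div h2)).add
    ((MeromorphicAt.const _ w).div (h2.sub (MeromorphicAt.const (D : ℂ) w)))

theorem exists_contTransform_bound {b D : ℝ} :
    ∃ C T₀ : ℝ, ∀ w : ℂ, w.re ≤ b → T₀ ≤ |w.im| →
      ‖contTransform α c G D w‖ ≤ C / w.im ^ 2 := by
  set ρ : ℝ := α / c * ∫ y, y ∂G with hρ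
  set K : ℝ := α / c * (mgf id G b + 1) with hK
  set Λ : ℝ := mgf id (tiltedLadder α c 0 G) b with hΛ
  have hρ0 : 0 < ρ := H.rho_pos
  have hρ1 : ρ < 1 := H.rho_lt_one
  -- `|Im w| ≥ 2K` gives `‖L(w)‖ ≤ 1/2`, hence `‖1 - L(w)‖ ≥ 1/2`, which is the factor `2` in front;
  -- `|Im w| ≥ 1` keeps `w` and `w - D` away from zero.
  refine ⟨2 * ((1 - ρ) * K + |D| * Λ + |D| * ρ), max (2 * K) 1, fun w hw hT => ?_⟩
  have hwim : 1 ≤ |w.im| := (le_max_right _ _).trans hT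
  have hwK : 2 * K ≤ ‖w‖ := ((le_max_left _ _).trans hT).trans (Complex.abs_im_le_norm w)
  have hw1 : 1 ≤ ‖w‖ := hwim.trans (Complex.abs_im_le_norm w)
  have hw0 : w ≠ 0 := norm_pos_iff.1 (by linarith)
  have hwD' : |w.im| ≤ ‖w - D‖ := by
    have := Complex.abs_im_le_norm (w - D)
    simpa using this
  have hwD : w - D ≠ 0 := norm_pos_iff.1 (by linarith)
  have hwL : ‖w * ladderMGF α c G w‖ ≤ K := H.norm_mul_ladderMGF_le hw
  have hLhalf : ‖ladderMGF α c G w‖ ≤ 1 / 2 := by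
    rw [norm_mul] at hwL
    by_contra! hcon
    nlinarith
  have hLΛ : ‖ladderMGF α c G w‖ ≤ Λ :=
    (norm_ladderMGF_le (α := α) (c := c) (G := G) w).trans (H.strictMono_mgf_ladder.monotone hw)
  have h1L : 1 / 2 ≤ ‖1 - ladderMGF α c G w‖ := by
    have := norm_sub_norm_le (1 : ℂ) (ladderMGF α c G w)
    rw [norm_one] at this
    linarith
  have h1L0 : 1 - ladderMGF α c G w ≠ 0 := norm_pos_iff.1 (by linarith)
  -- Over the common denominator the terms `± ρ w` cancel, thanks to the correction `ρ / (w - D)`.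
  -- The numerator that remains is bounded, while the denominator grows quadratically in `Im w`.
  have e : contTransform α c G D w =
      ((1 - ρ : ℝ) * (w * ladderMGF α c G w) - D * ladderMGF α c G w + D * ρ) /
        (w * (w - D) * (1 - ladderMGF α c G w)) := by
    rw [contTransform, ← hρ]
    push_cast
    field_simp
    ring
  rw [e, norm_div, norm_mul, norm_mul]
  have hnum : ‖((1 - ρ : ℝ) * (w * ladderMGF α c G w) - D * ladderMGF α c G w + D * ρ)‖ ≤
      (1 - ρ) * K + |D| * Λ + |D| * ρ := by
    refine (norm_add_le _ _).trans (add_le_add ((norm_sub_le _ _).trans (add_le_add ?_ ?_)) ?_)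
    · rw [norm_mul, Complex.norm_real, Real.norm_of_nonneg (by linarith)]
      gcongr
    · rw [norm_mul, Complex.norm_real, Real.norm_eq_abs]
      gcongr
    · rw [norm_mul, Complex.norm_real, Complex.norm_real, Real.norm_eq_abs,
        Real.norm_of_nonneg hρ0.le]
  have hden : w.im ^ 2 * (1 / 2) ≤ ‖w‖ * ‖w - D‖ * ‖1 - ladderMGF α c G w‖ := by
    rw [← sq_abs, sq]
    gcongr
    exact Complex.abs_im_le_norm w
  have him : 0 < w.im ^ 2 := by rw [← sq_abs]; positivity
  calc _ ≤ ((1 - ρ) * K + |D| * Λ + |D| * ρ) / (w.im ^ 2 * (1 / 2)) := by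
        gcongr
        exact (norm_nonneg _).trans hnum
    _ = _ := by field_simp

end IsClaimModel

namespace IsRuinFunction

open FourierTransform Real

variable {α c κ : ℝ} {G : Measure ℝ} {ψ : ℝ → ℝ} (h : IsRuinFunction α c κ G ψ)
  (H : IsClaimModel α c G) (hκ : mgf id (tiltedLadder α c 0 G) κ = 1)
include h H hκ

theorem inversion {a D : ℝ} (ha : 0 < a) (haκ : a < κ) (haD : a < D)
    (hint : Integrable fun t : ℝ => contTransform α c G D (a + t * Complex.I))
    {x : ℝ} (hx : 0 < x) :
    (ψ x : ℂ) - (α / c * ∫ y, y ∂G : ℝ) * Complex.exp (-D * x) =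
      (2 * π)⁻¹ * ∫ t : ℝ, Complex.exp (-x * (a + t * Complex.I)) *
        contTransform α c G D (a + t * Complex.I) := by
  set ρ : ℝ := α / c * ∫ y, y ∂G with hρ
  -- The weight `e^{ax}` moves the Fourier transform onto the line `Re w = a`; it keeps `v`
  -- integrable because `a < κ` and `a < D`.
  set v : ℝ → ℂ := fun x => Complex.exp (a * x) * (ψ x - ρ * Complex.exp (-D * x)) with hv
  have hexp : ∀ w : ℂ, w.re < D →
      IntegrableOn (fun x : ℝ => Complex.exp ((w - D) * x)) (Set.Ici 0) := by
    intro w hw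
    rw [integrableOn_Ici_iff_integrableOn_Ioi]
    exact integrableOn_exp_mul_complex_Ioi (by simp; linarith) 0
  have hvw : ∀ (w : ℂ) (x : ℝ), Complex.exp (w * x) * (ψ x - ρ * Complex.exp (-D * x)) =
      Complex.exp (w * x) * ψ x - ρ * Complex.exp ((w - D) * x) := by
    intro w x
    rw [sub_mul, Complex.exp_sub, neg_mul, Complex.exp_neg]
    field_simp
  have hvint : IntegrableOn v (Set.Ici 0) := by
    simp only [hv, hvw]
    exact (h.integrableOn (by simpa using haκ)).sub ((hexp _ (by simpa using haD)).const_mul _)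
  set F : ℝ → ℂ := (Set.Ici (0 : ℝ)).indicator v with hF
  have hFint : Integrable F := (integrable_indicator_iff measurableSet_Ici).2 hvint
  have htrans : ∀ t : ℝ, 𝓕 F t = contTransform α c G D (a + (-(2 * π) * t : ℝ) * Complex.I) := by
    intro t
    set w : ℂ := a + (-(2 * π) * t : ℝ) * Complex.I with hw
    have hwre : w.re = a := by simp [hw]
    rw [fourier_real_eq_integral_exp_smul]
    have e1 : ∀ y : ℝ, Complex.exp (↑(-2 * π * y * t) * Complex.I) • F y =
        (Set.Ici (0 : ℝ)).indicator (fun y : ℝ => Complex.exp (w * y) * ψ y -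
          ρ * Complex.exp ((w - D) * y)) y := by
      intro y
      simp only [hF, Set.indicator_apply]
      split_ifs
      · rw [← hvw, smul_eq_mul, hv, ← mul_assoc, ← Complex.exp_add]
        congr 2
        rw [hw]; push_cast; ring
      · simp
    simp only [e1]
    have hwD : w - D ≠ 0 := fun h0 => by
      have := congrArg Complex.re h0
      simp [hwre] at this
      linarith
    rw [integral_indicator measurableSet_Ici, integral_sub (h.integrableOn (by rw [hwre]; exact haκ))
      ((hexp w (by rw [hwre]; exact haD)).const_mul _), integral_const_mul, ← ruinTransform,
      h.ruinTransform_eq H hκ (by rw [hwre]; exact ha) (by rw [hwre]; exact haκ),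
      integral_Ici_eq_integral_Ioi, integral_exp_mul_complex_Ioi (by simp [hwre]; linarith),
      contTransform, ← hρ]
    simp only [Complex.ofReal_zero, mul_zero, Complex.exp_zero]
    ring
  have hπ : (-(2 * π)) ≠ 0 := by have := Real.pi_pos; linarith
  have hFFint : Integrable (𝓕 F) := by
    rw [funext htrans]
    exact hint.comp_mul_left' hπ
  have hcont : ContinuousAt F x := by
    have h1 : ContinuousAt v x := by
      have := h.continuousAt H hx (ha.trans haκ)
      have h2 : ContinuousAt (fun y => (ψ y : ℂ)) x :=
        Complex.continuous_ofReal.continuousAt.comp this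
      exact ContinuousAt.mul (by fun_prop) (h2.sub (by fun_prop))
    refine h1.congr ?_
    filter_upwards [lt_mem_nhds hx] with y hy
    rw [hF, Set.indicator_of_mem (by exact hy.le)]
  have hinv := hFint.fourierInv_fourier_eq hFFint hcont
  rw [fourierInv_eq', hF, Set.indicator_of_mem (by exact hx.le)] at hinv
  have e2 : ∀ t : ℝ, Complex.exp (↑(2 * π * inner ℝ t x) * Complex.I) • 𝓕 F t =
      (fun s : ℝ => Complex.exp (-x * (s * Complex.I)) *
        contTransform α c G D (a + s * Complex.I)) (-(2 * π) * t) := by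
    intro t
    rw [htrans, smul_eq_mul]
    congr 2
    simp only [RCLike.inner_apply, conj_trivial]
    push_cast; ring
  rw [← hF] at hinv
  simp only [e2] at hinv
  -- The substitution `s = -2πt` passes from Fourier frequency to height on the line and produces
  -- the factor `(2π)⁻¹`.
  rw [Measure.integral_comp_mul_left (fun s : ℝ => Complex.exp (-x * (s * Complex.I)) *
        contTransform α c G D (a + s * Complex.I))] at hinv
  have h3 : |(-(2 * π))⁻¹| = (2 * π)⁻¹ := by
    rw [abs_inv, abs_neg, abs_of_pos (by positivity)]
  rw [h3, Complex.real_smul, hv] at hinv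
  beta_reduce at hinv
  have h4 : (ψ x : ℂ) - ρ * Complex.exp (-D * x) = Complex.exp (-x * a) *
      (Complex.exp (a * x) * (ψ x - ρ * Complex.exp (-D * x))) := by
    rw [← mul_assoc, ← Complex.exp_add]
    ring_nf
    simp
  rw [h4, ← hinv, mul_left_comm, ← integral_const_mul]
  push_cast
  congr 1
  congr 1
  ext t
  rw [← mul_assoc, ← Complex.exp_add, mul_add]

theorem expansion {R : ℝ} (hR : 0 < R) (hκ0 : 0 < κ) (S : Finset ℂ)
    (hS : ∀ w, w ∈ S ↔ w.re ≤ R ∧ ladderMGF α c G w = 1) :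
    (fun x : ℝ => (ψ x : ℂ) - ∑ w ∈ S, residue (residueKernel α c G x) w) =o[atTop]
      fun x : ℝ => Real.exp (-R * x) := by
  set ρ : ℝ := α / c * ∫ y, y ∂G with hρ
  -- Finitely many roots have real part at most `R + 1`, so there is a gap to the right of `R`;
  -- choosing `b` inside it adds no root and leaves room for the little-o.
  obtain ⟨b, hbR, hb⟩ : ∃ b, R < b ∧ ∀ w : ℂ, w.re ≤ b → ladderMGF α c G w = 1 → w ∈ S := by
    have hfin := H.finite_roots (R + 1)
    have hev : ∀ᶠ b in 𝓝[>] R, ∀ w ∈ hfin.toFinset, w.re ≤ b → w ∈ S := by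
      rw [Filter.eventually_all_finset]
      intro w hw
      rw [Set.Finite.mem_toFinset] at hw
      rcases le_or_gt w.re R with hwR | hwR
      · exact Eventually.of_forall fun b _ => (hS w).2 ⟨hwR, hw.2⟩
      · filter_upwards [Ioo_mem_nhdsGT hwR] with b hb' hle
        exact absurd hle (not_le.2 hb'.2)
    obtain ⟨b, hb, hb'⟩ := (hev.and (Ioo_mem_nhdsGT (lt_add_one R))).exists
    exact ⟨b, hb'.1, fun w hw hL => hb w (by simpa using ⟨hw.trans hb'.2.le, hL⟩) hw⟩
  -- `R` may be smaller than `κ`, so the starting line has to lie to the left of both `κ` and `b`.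
  set a : ℝ := min κ b / 2 with ha
  have hmin : 0 < min κ b := lt_min hκ0 (hR.trans hbR)
  have ha0 : 0 < a := by rw [ha]; linarith
  have haκ : a < κ := by have := min_le_left κ b; linarith
  have hab : a < b := by have := min_le_right κ b; linarith
  -- The auxiliary pole `D` lies to the right of the strip and is never crossed; `e^{-Dx}` is then
  -- smaller than the remainder `e^{-bx}`.
  set D : ℝ := b + 1 with hD
  obtain ⟨C, T₀, hbd⟩ := H.exists_contTransform_bound (b := b) (D := D)
  have hloc : ∀ p ∈ S, p.re ∈ Set.Ioo a b := fun p hp =>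
    ⟨haκ.trans_le (H.le_re_of_root hκ ((hS p).1 hp).2), ((hS p).1 hp).1.trans_lt hbR⟩
  have hdiff : ∀ z : ℂ, z.re ∈ Set.Icc a b → z ∉ S →
      DifferentiableAt ℂ (contTransform α c G D) z := by
    intro z hz hzS
    refine H.differentiableAt_contTransform ?_ ?_ fun hL => hzS (hb z hz.2 hL)
    · rintro rfl
      exact ha0.not_ge hz.1
    · rintro rfl
      have := hz.2
      rw [Complex.ofReal_re] at this
      linarith
  obtain ⟨hia, hib, -⟩ := contour_shift hab.le S hloc
    (fun p _ => H.meromorphicAt_contTransform D p) hdiff (fun z hz hT => hbd z hz.2 hT)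
  set I : ℝ := ∫ t : ℝ, ‖contTransform α c G D (b + t * Complex.I)‖ with hI
  have hmain : ∀ x : ℝ, 0 < x →
      ‖(ψ x : ℂ) - ∑ w ∈ S, residue (residueKernel α c G x) w‖ ≤
        ((2 * π)⁻¹ * I + ρ) * Real.exp (-b * x) := by
    intro x hx
    set f : ℂ → ℂ := fun w => Complex.exp (-x * w) * contTransform α c G D w with hf
    have hE : Differentiable ℂ fun w : ℂ => Complex.exp (-x * w) := by fun_prop
    have hfm : ∀ p, MeromorphicAt f p := fun p =>
      (hE.analyticAt p).meromorphicAt.mul (H.meromorphicAt_contTransform D p)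
    have hC : 0 ≤ |C| := abs_nonneg C
    obtain ⟨-, -, hshift⟩ := contour_shift (f := f) (C := |C|) (T₀ := T₀) hab.le S hloc
      (fun p _ => hfm p) (fun z hz hzS => (hE z).mul (hdiff z hz hzS)) (fun z hz hT => by
        rw [hf, norm_mul, Complex.norm_exp]
        have h1 : (-(x : ℂ) * z).re ≤ 0 := by
          simp
          exact mul_nonneg hx.le (ha0.le.trans hz.1)
        calc _ ≤ 1 * (C / z.im ^ 2) := by
              gcongr
              · exact Real.exp_le_one_iff.2 h1
              · exact hbd z hz.2 hT
          _ ≤ _ := by rw [one_mul]; gcongr; exact le_abs_self C)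
    -- The two functions differ, up to sign, by the terms with poles at `0` and `D`. These are
    -- analytic at every root in the strip.
    have hres : ∀ p ∈ S, residue (residueKernel α c G x) p = -residue f p := by
      intro p hp
      have hp0 : p ≠ 0 := by
        rintro rfl
        exact ha0.not_gt (hloc 0 hp).1
      have hpD : p - D ≠ 0 := by
        intro h0
        have h1 := (hloc p hp).2
        rw [sub_eq_zero.1 h0, Complex.ofReal_re] at h1
        linarith
      have han : AnalyticAt ℂ (fun w : ℂ => Complex.exp (-x * w) * (ρ / (w - D) - 1 / w)) p := by
        refine (hE.analyticAt p).mul (AnalyticAt.sub ?_ ?_)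
        · exact analyticAt_const.div (by fun_prop) hpD
        · exact analyticAt_const.div (by fun_prop) hp0
      have := (((hasResidue_residue (hfm p)).const_mul (-1)).add (hasResidue_of_analyticAt han)).congr
        (g := residueKernel α c G x) (Eventually.of_forall fun z => by
          simp only [hf, contTransform, residueKernel, ← hρ]; ring)
      rw [this.residue_eq]; ring
    have hinv := h.inversion H hκ (D := D) ha0 haκ (by linarith) hia hx
    rw [← hρ] at hinv
    change _ = _ * ∫ t : ℝ, f (a + t * Complex.I) at hinv
    rw [hshift] at hinv
    have h2π : ∀ z : ℂ, ((2 * π)⁻¹ : ℝ) * (2 * π * z) = z := fun z => by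
      have hπ : (π : ℂ) ≠ 0 := by exact_mod_cast Real.pi_ne_zero
      push_cast
      field_simp
    have heq : (ψ x : ℂ) - ∑ w ∈ S, residue (residueKernel α c G x) w =
        (2 * π)⁻¹ * (∫ t : ℝ, f (b + t * Complex.I)) + ρ * Complex.exp (-D * x) := by
      rw [Finset.sum_congr rfl hres, Finset.sum_neg_distrib]
      rw [mul_sub, h2π] at hinv
      linear_combination hinv
    rw [heq]
    refine (norm_add_le _ _).trans ?_
    rw [add_mul]
    refine add_le_add ?_ ?_
    · rw [norm_mul, mul_assoc]
      rw [Complex.norm_real, Real.norm_of_nonneg (by positivity)]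
      refine mul_le_mul_of_nonneg_left ?_ (by positivity)
      refine (norm_integral_le_integral_norm _).trans (le_of_eq ?_)
      rw [hI, ← integral_mul_const]
      congr 1
      ext t
      rw [hf, norm_mul, Complex.norm_exp, mul_comm]
      simp [mul_comm]
    · rw [norm_mul, Complex.norm_real, Real.norm_of_nonneg H.rho_pos.le, Complex.norm_exp]
      have : (-(D : ℂ) * x).re = -D * x := by simp
      rw [this]
      have hρ0 := H.rho_pos
      gcongr
      linarith
  refine (IsBigO.of_bound ((2 * π)⁻¹ * I + ρ) (g := fun x => Real.exp (-b * x)) ?_).trans_isLittleO ?_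
  · filter_upwards [eventually_gt_atTop 0] with x hx
    rw [Real.norm_of_nonneg (Real.exp_pos _).le]
    exact hmain x hx
  · rw [Real.isLittleO_exp_comp_exp_comp]
    have : ∀ x, -R * x - -b * x = (b - R) * x := fun x => by ring
    simp only [this]
    exact tendsto_id.const_mul_atTop (by linarith)

end IsRuinFunction

/-! ### The terms of the expansion -/

/-- The theorem centres its roots at `κ`, the contour argument uses `w = z + κ`; this passes between
the two. -/
theorem residue_comp_add (f : ℂ → ℂ) (p a : ℂ) :
    residue (fun z => f (z + a)) p = residue f (p + a) := by
  have : ∀ ε : ℝ, (∮ z in C(p, ε), f (z + a)) = ∮ z in C(p + a, ε), f z := fun ε => by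
    simp only [circleIntegral, deriv_circleMap, circleMap, add_right_comm]
  simp only [residue, this]

namespace IsClaimModel

variable {α c κ : ℝ} {G : Measure ℝ} (H : IsClaimModel α c G)
include H

theorem expansionTerm_eq_residue (x : ℝ) (z : ℂ) :
    expansionTerm α c κ G x z = residue (residueKernel α c G x) (z + κ) := by
  have hc : (c : ℂ) ≠ 0 := by exact_mod_cast H.c_pos.ne'
  rw [expansionTerm, ← residue_comp_add]
  congr 1
  ext z
  rw [residueKernel, ← H.tiltedMGF_eq κ z, mul_assoc (c : ℂ), mul_comm (1 - tiltedMGF α c κ G z),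
    div_mul_eq_div_div]
  congr 1
  push_cast
  field_simp
  ring

theorem deriv_tiltedMGF (z : ℂ) :
    deriv (tiltedMGF α c κ G) z = deriv (ladderMGF α c G) (z + κ) := by
  rw [funext (H.tiltedMGF_eq κ), deriv_comp_add_const]

theorem differentiable_tiltedMGF : Differentiable ℂ (tiltedMGF α c κ G) := by
  rw [funext (H.tiltedMGF_eq κ)]
  exact H.differentiable_ladderMGF.comp (differentiable_id.add_const _)

theorem ne_zero_of_root {w : ℂ} (hw : ladderMGF α c G w = 1) : w ≠ 0 := by
  rintro rfl
  rw [H.ladderMGF_zero] at hw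
  exact H.rho_lt_one.ne (by exact_mod_cast hw)

theorem expansionTerm_simple {z : ℂ} (hz : tiltedMGF α c κ G z = 1)
    (hd : deriv (tiltedMGF α c κ G) z ≠ 0) (x : ℝ) :
    expansionTerm α c κ G x z =
      -((α * (∫ y, y ∂G : ℝ) - c) / (c * deriv (tiltedMGF α c κ G) z * (z + κ))) *
        Complex.exp (-x * (z + κ)) := by
  have hc : (c : ℂ) ≠ 0 := by exact_mod_cast H.c_pos.ne'
  have hw : z + κ ≠ 0 := H.ne_zero_of_root (by rw [← H.tiltedMGF_eq, hz])
  have hg : Differentiable ℂ (tiltedMGF α c κ G) := H.differentiable_tiltedMGF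
  have hq : deriv (fun z => 1 - tiltedMGF α c κ G z) z = -deriv (tiltedMGF α c κ G) z := by
    rw [deriv_const_sub]
  have hE : Differentiable ℂ fun z : ℂ => (α * (∫ y, y ∂G : ℝ) - c) * Complex.exp (-x * (z + κ)) := by
    fun_prop
  have hden : Differentiable ℂ fun z : ℂ => (c : ℂ) * (z + κ) := by fun_prop
  have := (hasResidue_div ((hE.analyticAt z).div (hden.analyticAt z) (mul_ne_zero hc hw))
    ((hg.const_sub 1).analyticAt z) (by simp [hz]) (by rw [hq]; exact neg_ne_zero.2 hd)).congr
    (g := fun z => (α * (∫ y, y ∂G : ℝ) - c) * Complex.exp (-x * (z + κ)) /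
      (c * (1 - tiltedMGF α c κ G z) * (z + κ))) (Eventually.of_forall fun w => by
        simp only [Pi.div_apply]
        rw [div_div]; ring_nf)
  rw [expansionTerm, this.residue_eq, hq]
  simp only [Pi.div_apply]
  field_simp

theorem expansionTerm_simple' {z : ℂ} (hz : tiltedMGF α c κ G z = 1)
    (hd : deriv (tiltedMGF α c κ G) z ≠ 0) (x : ℝ) :
    expansionTerm α c κ G x z =
      (c - α * (∫ y, y ∂G : ℝ)) / (α * (∫ y : ℝ, y * Complex.exp ((z + κ) * y) ∂G) - c) *
        Complex.exp (-(z + κ) * x) := by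
  have hr := H.deriv_root (w := z + κ) (by rw [← H.tiltedMGF_eq, hz])
  rw [H.expansionTerm_simple hz hd, H.deriv_tiltedMGF, hr, ← neg_div, neg_sub,
    show -(x : ℂ) * (z + κ) = -(z + κ) * x by ring]

section

variable (hκ : mgf id (tiltedLadder α c 0 G) κ = 1)
include hκ

theorem tiltedMGF_zero : tiltedMGF α c κ G 0 = 1 := by
  rw [H.tiltedMGF_eq, zero_add, ladderMGF_ofReal, hκ, Complex.ofReal_one]

omit hκ in
theorem deriv_tiltedMGF_zero : deriv (tiltedMGF α c κ G) 0 =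
    (∫ y, y * Real.exp (κ * y) ∂(tiltedLadder α c 0 G) : ℝ) := by
  have h := hasDerivAt_complexMGF (X := id) (μ := tiltedLadder α c 0 G) (z := (κ : ℂ))
    (by simp [H.integrableExpSet_ladder])
  rw [H.deriv_tiltedMGF, zero_add, ladderMGF, h.deriv, ← integral_complex_ofReal]
  simp

omit hκ in
theorem deriv_tiltedMGF_zero_ne : deriv (tiltedMGF α c κ G) 0 ≠ 0 := by
  rw [H.deriv_tiltedMGF_zero]
  exact_mod_cast (H.integral_mul_exp_ladder_pos κ).ne'

omit H hκ in
theorem integral_claim_ofReal : ∫ y : ℝ, (y : ℂ) * Complex.exp ((0 + κ) * y) ∂G =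
    (∫ y, y * Real.exp (κ * y) ∂G : ℝ) := by
  rw [← integral_complex_ofReal]
  simp

/-- By `deriv_root` the quantity equals `c κ L'(κ)`, and `L'(κ)` is the integral of a function
positive almost everywhere on the ladder measure. -/
theorem lundberg_denominator_pos (hκ0 : 0 < κ) : 0 < α * (∫ y, y * Real.exp (κ * y) ∂G) - c := by
  have hr := H.deriv_root (w := 0 + κ) (by rw [← H.tiltedMGF_eq, H.tiltedMGF_zero hκ])
  rw [← H.deriv_tiltedMGF, H.deriv_tiltedMGF_zero, integral_claim_ofReal, zero_add] at hr
  have hr' : c * (∫ y, y * Real.exp (κ * y) ∂(tiltedLadder α c 0 G)) * κ =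
    α * (∫ y, y * Real.exp (κ * y) ∂G) - c := by exact_mod_cast hr
  rw [← hr']
  exact mul_pos (mul_pos H.c_pos (H.integral_mul_exp_ladder_pos κ)) hκ0

theorem expansionTerm_zero (x : ℝ) : expansionTerm α c κ G x 0 =
    ((c - α * ∫ y, y ∂G) / (α * (∫ y, y * Real.exp (κ * y) ∂G) - c) * Real.exp (-κ * x) : ℝ) := by
  rw [H.expansionTerm_simple' (H.tiltedMGF_zero hκ) H.deriv_tiltedMGF_zero_ne, integral_claim_ofReal]
  push_cast
  simp

end

end IsClaimModel

namespace IsRuinFunction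

variable {α c κ : ℝ} {G : Measure ℝ} {ψ : ℝ → ℝ} (h : IsRuinFunction α c κ G ψ)
  (H : IsClaimModel α c G) (hκ : mgf id (tiltedLadder α c 0 G) κ = 1) (hκ0 : 0 < κ)
include h H hκ hκ0

theorem exists_expansion {r : ℝ} (hr : 0 < r) : ∃ S : Finset ℂ,
    (∀ z : ℂ, z ∈ S ↔ z.re ≤ r ∧ tiltedMGF α c κ G z = 1) ∧ (0 : ℂ) ∈ S ∧
    (fun x : ℝ => (ψ x : ℂ) - ∑ z ∈ S, expansionTerm α c κ G x z)
      =o[atTop] fun x : ℝ => Real.exp (-(r + κ) * x) := by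
  have hfin := H.finite_roots (r + κ)
  set S := hfin.toFinset.map (addRightEmbedding (-(κ : ℂ))) with hSdef
  have hS : ∀ z : ℂ, z ∈ S ↔ z.re ≤ r ∧ tiltedMGF α c κ G z = 1 := by
    intro z
    simp only [hSdef, Finset.mem_map, Set.Finite.mem_toFinset, Set.mem_ofPred_eq,
      addRightEmbedding_apply, H.tiltedMGF_eq]
    constructor
    · rintro ⟨w, ⟨hw, hw1⟩, rfl⟩
      simpa [hw1] using hw
    · rintro ⟨hz, hz1⟩
      exact ⟨z + κ, ⟨by simpa using hz, hz1⟩, by simp⟩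
  refine ⟨S, hS, (hS 0).2 ⟨hr.le, H.tiltedMGF_zero hκ⟩, ?_⟩
  refine (h.expansion H hκ (R := r + κ) (by linarith) hκ0 hfin.toFinset
    fun w => by simp).congr_left fun x => ?_
  rw [hSdef, Finset.sum_map]
  simp [H.expansionTerm_eq_residue]

/-- No root other than `0` has `Re z ≤ 0` and there are finitely many nearby, so a small `r > 0`
leaves the single term of `0`. Its constant is positive, so an error `o(e^{-(r + κ)x})` is
negligible against it. -/
theorem isEquivalent : ψ ~[atTop] fun x : ℝ =>
    (c - α * ∫ y, y ∂G) / (α * (∫ y, y * Real.exp (κ * y) ∂G) - c) * Real.exp (-κ * x) := by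
  obtain ⟨r, hr, hroot⟩ : ∃ r : ℝ, 0 < r ∧ ∀ z : ℂ, z.re ≤ r → tiltedMGF α c κ G z = 1 → z = 0 := by
    have hfin := H.finite_roots (1 + κ)
    have hev : ∀ᶠ r in 𝓝[>] (0 : ℝ), ∀ w ∈ hfin.toFinset, w.re ≤ r + κ → w = κ := by
      rw [Filter.eventually_all_finset]
      intro w hw
      rw [Set.Finite.mem_toFinset] at hw
      rcases le_or_gt w.re κ with hwR | hwR
      · exact Eventually.of_forall fun b _ => H.root_eq_of_re_le hκ hw.2 hwR
      · filter_upwards [Ioo_mem_nhdsGT (sub_pos.2 hwR)] with b hb' hle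
        have := hb'.2
        linarith
    obtain ⟨r, hr, hr'⟩ := (hev.and (Ioo_mem_nhdsGT one_pos)).exists
    refine ⟨r, hr'.1, fun z hz hz1 => ?_⟩
    have := hr (z + κ) (by
      rw [Set.Finite.mem_toFinset]
      refine ⟨?_, by rw [← H.tiltedMGF_eq, hz1]⟩
      simpa using hz.trans hr'.2.le) (by simpa using hz)
    simpa using this
  obtain ⟨S, hS, h0, hexp⟩ := h.exists_expansion H hκ hκ0 hr
  have hS0 : S = {0} := by
    ext z
    rw [Finset.mem_singleton]
    exact ⟨fun hz => hroot z ((hS z).1 hz).1 ((hS z).1 hz).2, fun hz => hz ▸ h0⟩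
  subst hS0
  simp only [Finset.sum_singleton, H.expansionTerm_zero hκ, ← Complex.ofReal_sub] at hexp
  set C := (c - α * ∫ y, y ∂G) / (α * (∫ y, y * Real.exp (κ * y) ∂G) - c) with hC
  have hCpos : 0 < C := div_pos H.safe (H.lundberg_denominator_pos hκ hκ0)
  have h1 : (fun x : ℝ => ψ x - C * Real.exp (-κ * x)) =o[atTop]
      fun x : ℝ => Real.exp (-(r + κ) * x) := by
    have h2 := hexp.norm_left
    simp only [Complex.norm_real] at h2
    exact h2.of_norm_left
  refine h1.trans_isBigO (IsBigO.of_bound C⁻¹ ?_)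
  filter_upwards [eventually_ge_atTop 0] with x hx
  rw [norm_mul, Real.norm_of_nonneg hCpos.le, inv_mul_cancel_left₀ hCpos.ne',
    Real.norm_of_nonneg (Real.exp_pos _).le, Real.norm_of_nonneg (Real.exp_pos _).le]
  gcongr
  linarith

end IsRuinFunction

/-! ### The embedded random walk -/

/-- Prepend a term to a sequence. -/
def consSeq (q : ℝ × (ℕ → ℝ)) : ℕ → ℝ
  | 0 => q.1
  | k + 1 => q.2 k

theorem measurable_consSeq : Measurable consSeq := by
  refine measurable_pi_iff.2 fun k => ?_
  cases k with
  | zero => exact measurable_fst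
  | succ k => exact (measurable_pi_apply k).comp measurable_snd

/-- An independent sample put in front of an i.i.d. sequence gives an i.i.d. sequence again, checked
on finite cylinders. This is what allows conditioning on the first step of the walk. -/
theorem map_consSeq (μ : Measure ℝ) [IsProbabilityMeasure μ] :
    (μ.prod (Measure.infinitePi fun _ : ℕ => μ)).map consSeq = Measure.infinitePi fun _ : ℕ => μ := by
  classical
  refine Measure.eq_infinitePi _ fun s t ht => ?_
  obtain ⟨n, hn⟩ : ∃ n, s ⊆ Finset.range (n + 1) :=
    ⟨s.sup id, fun i hi => Finset.mem_range.2 (Nat.lt_succ_of_le (Finset.le_sup (f := id) hi))⟩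
  -- Unconstrained coordinates are padded with the whole line, so that the cylinder lives on an
  -- initial segment and splits into its coordinate `0` and a shifted rest.
  set t' : ℕ → Set ℝ := fun i => if i ∈ s then t i else Set.univ with ht'
  have hmeas : ∀ i, MeasurableSet (t' i) := fun i => by
    simp only [ht']; split_ifs
    · exact ht i
    · exact MeasurableSet.univ
  have hpre : consSeq ⁻¹' ((s : Set ℕ).pi t) =
      t' 0 ×ˢ ((Finset.range n : Finset ℕ) : Set ℕ).pi (fun i => t' (i + 1)) := by
    ext q
    simp only [Set.mem_preimage, Set.mem_pi, Set.mem_prod, ht', Finset.mem_coe, Finset.mem_range]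
    constructor
    · intro hq
      refine ⟨?_, fun i _ => ?_⟩
      · split_ifs with h0
        · exact hq 0 h0
        · trivial
      · split_ifs with h0
        · exact hq (i + 1) h0
        · trivial
    · rintro ⟨h0, h1⟩ i hi
      cases i with
      | zero => rwa [if_pos hi] at h0
      | succ i =>
        have := h1 i (by have := Finset.mem_range.1 (hn hi); omega)
        rwa [if_pos hi] at this
  have hsm : MeasurableSet ((s : Set ℕ).pi t) := MeasurableSet.pi s.countable_toSet fun i _ => ht i
  rw [Measure.map_apply measurable_consSeq hsm, hpre, Measure.prod_prod,
    Measure.infinitePi_pi _ (fun i _ => hmeas (i + 1)), mul_comm,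
    ← Finset.prod_range_succ' (fun i => μ (t' i))]
  symm
  refine Finset.prod_subset_one_on_sdiff hn (fun i hi => ?_) (fun i hi => ?_)
  · simp [ht', (Finset.mem_sdiff.1 hi).2]
  · simp [ht', hi]

/-- The probability that the random walk with steps `Z_k - c T_k` exceeds `x` at some time in `J`. -/
def walkProb (c : ℝ) (E G : Measure ℝ) (J : Set ℕ) (x : ℝ) : ℝ≥0∞ :=
  ((Measure.infinitePi fun _ : ℕ => E).prod (Measure.infinitePi fun _ : ℕ => G))
    {q | ∃ j ∈ J, x < ∑ k ∈ Finset.range j, (q.2 k - c * q.1 k)}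

theorem measurableSet_walk (c : ℝ) (J : Set ℕ) :
    MeasurableSet {q : ℝ × (ℕ → ℝ) × (ℕ → ℝ) |
      ∃ j ∈ J, q.1 < ∑ k ∈ Finset.range j, (q.2.2 k - c * q.2.1 k)} := by
  have : {q : ℝ × (ℕ → ℝ) × (ℕ → ℝ) |
      ∃ j ∈ J, q.1 < ∑ k ∈ Finset.range j, (q.2.2 k - c * q.2.1 k)} =
      ⋃ j ∈ J, {q | q.1 < ∑ k ∈ Finset.range j, (q.2.2 k - c * q.2.1 k)} := by
    ext q; simp
  rw [this]
  refine MeasurableSet.biUnion J.to_countable fun j _ => measurableSet_lt measurable_fst ?_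
  fun_prop

/-- Condition on the first inter-arrival time and the first claim. A general time set `J` covers
both uses: the shift takes `Set.Iic (n + 1)` to `Set.Iic n` and fixes `Set.univ`. -/
theorem walkProb_step (c : ℝ) (E G : Measure ℝ) [IsProbabilityMeasure E] [IsProbabilityMeasure G]
    (J : Set ℕ) {x : ℝ} (hx : 0 ≤ x) :
    walkProb c E G J x =
      ∫⁻ t, ∫⁻ z, walkProb c E G (Nat.succ ⁻¹' J) (x + c * t - z) ∂G ∂E := by
  set IE := Measure.infinitePi fun _ : ℕ => E with hIE
  set IG := Measure.infinitePi fun _ : ℕ => G with hIG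
  set A : Set (ℝ × (ℕ → ℝ) × (ℕ → ℝ)) := {q | ∃ j ∈ Nat.succ ⁻¹' J,
    q.1 < ∑ k ∈ Finset.range j, (q.2.2 k - c * q.2.1 k)} with hA
  have hAm : MeasurableSet A := measurableSet_walk c _
  have hm0 : MeasurableSet {q : (ℕ → ℝ) × (ℕ → ℝ) |
      ∃ j ∈ J, x < ∑ k ∈ Finset.range j, (q.2 k - c * q.1 k)} :=
    (measurableSet_walk c J).preimage (measurable_const.prodMk measurable_id : Measurable fun q => (x, q))
  have hpre : Prod.map consSeq consSeq ⁻¹' {q : (ℕ → ℝ) × (ℕ → ℝ) |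
      ∃ j ∈ J, x < ∑ k ∈ Finset.range j, (q.2 k - c * q.1 k)} =
      {q : (ℝ × (ℕ → ℝ)) × (ℝ × (ℕ → ℝ)) | (x + c * q.1.1 - q.2.1, q.1.2, q.2.2) ∈ A} := by
    ext q
    simp only [Set.mem_preimage, Set.mem_ofPred_eq, hA]
    constructor
    · rintro ⟨j, hj, hlt⟩
      cases j with
      -- Time `0` cannot be the crossing time: the empty sum does not exceed `x ≥ 0`.
      | zero => simp at hlt; linarith
      | succ j =>
        refine ⟨j, hj, ?_⟩
        rw [Finset.sum_range_succ'] at hlt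
        simp only [Prod.map, consSeq] at hlt
        linarith
    · rintro ⟨j, hj, hlt⟩
      refine ⟨j + 1, hj, ?_⟩
      rw [Finset.sum_range_succ']
      simp only [Prod.map, consSeq]
      linarith
  have hBm : Measurable fun q : (ℝ × (ℕ → ℝ)) × (ℝ × (ℕ → ℝ)) =>
      (x + c * q.1.1 - q.2.1, q.1.2, q.2.2) := by fun_prop
  have h1 : walkProb c E G J x = ((E.prod IE).prod (G.prod IG))
      {q | (x + c * q.1.1 - q.2.1, q.1.2, q.2.2) ∈ A} := by
    rw [walkProb, ← map_consSeq E, ← map_consSeq G,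
      Measure.map_prod_map _ _ measurable_consSeq measurable_consSeq,
      Measure.map_apply (measurable_consSeq.prodMap measurable_consSeq) hm0, hpre]
  have h2 : ∀ y, walkProb c E G (Nat.succ ⁻¹' J) y = ∫⁻ t, IG {z | (y, t, z) ∈ A} ∂IE := fun y =>
    Measure.prod_apply ((measurableSet_walk c _).preimage
      (measurable_const.prodMk measurable_id : Measurable fun q => (y, q)))
  have hIGm : Measurable fun p : ℝ × (ℕ → ℝ) => IG {z | (p.1, p.2, z) ∈ A} :=
    measurable_measure_prodMk_left (hAm.preimage
      (by fun_prop : Measurable fun q : (ℝ × (ℕ → ℝ)) × (ℕ → ℝ) => (q.1.1, q.1.2, q.2)))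
  have hm3 : MeasurableSet {q : (ℝ × (ℕ → ℝ)) × (ℝ × (ℕ → ℝ)) |
      (x + c * q.1.1 - q.2.1, q.1.2, q.2.2) ∈ A} := hAm.preimage hBm
  rw [h1, Measure.prod_apply hm3, lintegral_prod _ (measurable_measure_prodMk_left hm3).aemeasurable]
  refine lintegral_congr fun t₀ => ?_
  simp only [h2]
  rw [lintegral_lintegral_swap]
  · refine lintegral_congr fun t => ?_
    have hm4 : MeasurableSet (Prod.mk (t₀, t) ⁻¹' {q : (ℝ × (ℕ → ℝ)) × (ℝ × (ℕ → ℝ)) |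
      (x + c * q.1.1 - q.2.1, q.1.2, q.2.2) ∈ A}) := hm3.preimage measurable_prodMk_left
    rw [Measure.prod_apply hm4]
    rfl
  · exact (hIGm.comp (by fun_prop : Measurable fun p : ℝ × (ℕ → ℝ) =>
      (x + c * t₀ - p.1, p.2))).aemeasurable

theorem walkProb_le_one (c : ℝ) (E G : Measure ℝ) [IsProbabilityMeasure E] [IsProbabilityMeasure G]
    (J : Set ℕ) (x : ℝ) : walkProb c E G J x ≤ 1 := prob_le_one

/-! ### Integrals against the exponential law -/

theorem lintegral_expMeasure_exp {α s : ℝ} (hα : 0 < α) (hs : 0 < α + s) :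
    ∫⁻ t, ENNReal.ofReal (Real.exp (-s * t)) ∂(expMeasure α) = ENNReal.ofReal (α / (α + s)) := by
  have hm : Measurable (exponentialPDF α) := (measurable_exponentialPDFReal α).ennreal_ofReal
  rw [expMeasure, gammaMeasure]
  change ∫⁻ t, _ ∂(volume.withDensity (exponentialPDF α)) = _
  rw [lintegral_withDensity_eq_lintegral_mul _ hm (by fun_prop)]
  have : ∀ t, (exponentialPDF α * fun t => ENNReal.ofReal (Real.exp (-s * t))) t =
      ENNReal.ofReal (α / (α + s)) * exponentialPDF (α + s) t := by
    intro t
    rw [Pi.mul_apply, exponentialPDF_eq, exponentialPDF_eq]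
    split_ifs with ht
    · rw [← ENNReal.ofReal_mul (by positivity), ← ENNReal.ofReal_mul (by positivity)]
      congr 1
      rw [mul_assoc, ← Real.exp_add, ← mul_assoc, div_mul_cancel₀ _ hs.ne']
      ring_nf
    · simp
  simp only [this]
  have hm' : Measurable (exponentialPDF (α + s)) :=
    (measurable_exponentialPDFReal (α + s)).ennreal_ofReal
  rw [lintegral_const_mul _ hm',
    lintegral_exponentialPDF_eq_one hs, mul_one]

theorem integral_expMeasure {α : ℝ} (hα : 0 < α) (f : ℝ → ℝ) :
    ∫ t, f t ∂(expMeasure α) = ∫ t in Set.Ioi (0 : ℝ), α * Real.exp (-α * t) * f t := by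
  have hm : Measurable (exponentialPDF α) := (measurable_exponentialPDFReal α).ennreal_ofReal
  rw [expMeasure, gammaMeasure]
  change ∫ t, _ ∂(volume.withDensity (exponentialPDF α)) = _
  rw [integral_withDensity_eq_integral_toReal_smul hm
    (Eventually.of_forall fun _ => ENNReal.ofReal_lt_top), ← integral_Ici_eq_integral_Ioi,
    ← integral_indicator measurableSet_Ici]
  congr 1
  ext t
  rw [exponentialPDF_eq, Set.indicator_apply]
  simp only [Set.mem_Ici]
  split_ifs
  · rw [ENNReal.toReal_ofReal (by positivity), smul_eq_mul, neg_mul]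
  · simp

namespace IsClaimModel

variable {α c κ : ℝ} {G : Measure ℝ} (H : IsClaimModel α c G)
  (hκ : mgf id (tiltedLadder α c 0 G) κ = 1) (hκ0 : 0 < κ)
include H hκ hκ0

omit hκ0 in
theorem mgf_claim_adjustment : mgf id G κ = 1 + κ * (c / α) := by
  have h := H.mul_ladderMGF κ
  rw [ladderMGF_ofReal, hκ, complexMGF_ofReal, Complex.ofReal_one, mul_one] at h
  have h' : κ = α / c * (mgf id G κ - 1) := by exact_mod_cast h
  have hα := H.α_pos.ne'
  have hc := H.c_pos.ne'
  field_simp at h' ⊢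
  linarith

/-- For `x < 0` the bound exceeds one. For `x ≥ 0` induct on the horizon: `e^{-κx}` is a fixed point
of the one-step operator, because `α / (α + κc)` times the claim generating function at `κ` is one.
-/
theorem walkProb_Iic_le (n : ℕ) : ∀ x : ℝ,
    walkProb c (expMeasure α) G (Set.Iic n) x ≤ ENNReal.ofReal (Real.exp (-κ * x)) := by
  have hG := H.isProb
  have hE := isProbabilityMeasure_expMeasure H.α_pos
  have hneg : ∀ (n : ℕ) (x : ℝ), x < 0 →
      walkProb c (expMeasure α) G (Set.Iic n) x ≤ ENNReal.ofReal (Real.exp (-κ * x)) := by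
    intro n x hx
    refine (walkProb_le_one _ _ _ _ _).trans ?_
    rw [ENNReal.one_le_ofReal]
    exact Real.one_le_exp (by nlinarith)
  induction n with
  | zero =>
    intro x
    rcases lt_or_ge x 0 with hx | hx
    · exact hneg 0 x hx
    · have : {q : (ℕ → ℝ) × (ℕ → ℝ) | ∃ j ∈ Set.Iic 0,
          x < ∑ k ∈ Finset.range j, (q.2 k - c * q.1 k)} = ∅ := by
        ext q; simpa using hx
      rw [walkProb, this, measure_empty]
      exact zero_le
  | succ n ih =>
    intro x
    rcases lt_or_ge x 0 with hx | hx
    · exact hneg _ x hx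
    · rw [walkProb_step _ _ _ _ hx]
      have hpre : Nat.succ ⁻¹' Set.Iic (n + 1) = Set.Iic n := by ext; simp
      rw [hpre]
      have hc := H.c_pos
      have hα := H.α_pos
      have hM : ∫⁻ z, ENNReal.ofReal (Real.exp (κ * z)) ∂G = ENNReal.ofReal (mgf id G κ) :=
        (ofReal_integral_eq_lintegral_ofReal (H.integrable_exp κ)
          (Eventually.of_forall fun z => (Real.exp_pos _).le)).symm
      calc _ ≤ ∫⁻ t, ∫⁻ z, ENNReal.ofReal (Real.exp (-κ * (x + c * t - z))) ∂G ∂(expMeasure α) :=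
            lintegral_mono fun t => lintegral_mono fun z => ih _
        _ = ∫⁻ t, ENNReal.ofReal (Real.exp (-κ * x)) * ENNReal.ofReal (Real.exp (-(κ * c) * t)) *
              ENNReal.ofReal (mgf id G κ) ∂(expMeasure α) := by
            refine lintegral_congr fun t => ?_
            rw [← hM, ← lintegral_const_mul _ (by fun_prop)]
            refine lintegral_congr fun z => ?_
            rw [← ENNReal.ofReal_mul (by positivity), ← ENNReal.ofReal_mul (by positivity),
              ← Real.exp_add, ← Real.exp_add]
            ring_nf
        _ = ENNReal.ofReal (Real.exp (-κ * x)) := by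
            rw [lintegral_mul_const _ (by fun_prop), lintegral_const_mul _ (by fun_prop),
              lintegral_expMeasure_exp hα (by positivity), mul_assoc,
              ← ENNReal.ofReal_mul (by positivity), H.mgf_claim_adjustment hκ]
            have : α / (α + κ * c) * (1 + κ * (c / α)) = 1 := by field_simp
            rw [this, ENNReal.ofReal_one, mul_one]

theorem walkProb_univ_le (x : ℝ) :
    walkProb c (expMeasure α) G Set.univ x ≤ ENNReal.ofReal (Real.exp (-κ * x)) := by
  have hmono : Monotone fun n : ℕ => {q : (ℕ → ℝ) × (ℕ → ℝ) | ∃ j ∈ Set.Iic n,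
      x < ∑ k ∈ Finset.range j, (q.2 k - c * q.1 k)} := by
    rintro m n hmn q ⟨j, hj, hlt⟩
    exact ⟨j, le_trans (Set.mem_Iic.1 hj) hmn, hlt⟩
  have : {q : (ℕ → ℝ) × (ℕ → ℝ) | ∃ j ∈ Set.univ, x < ∑ k ∈ Finset.range j, (q.2 k - c * q.1 k)} =
      ⋃ n : ℕ, {q | ∃ j ∈ Set.Iic n, x < ∑ k ∈ Finset.range j, (q.2 k - c * q.1 k)} := by
    ext q
    simp only [Set.mem_iUnion, Set.mem_ofPred_eq, Set.mem_univ, true_and, Set.mem_Iic]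
    exact ⟨fun ⟨j, hj⟩ => ⟨j, j, le_rfl, hj⟩, fun ⟨_, j, _, hj⟩ => ⟨j, hj⟩⟩
  rw [walkProb, this, hmono.measure_iUnion]
  exact iSup_le fun n => H.walkProb_Iic_le hκ hκ0 n x

theorem isRuinFunction_walkProb : IsRuinFunction α c κ G
    fun x => (walkProb c (expMeasure α) G Set.univ x).toReal := by
  have hG := H.isProb
  have hE := isProbabilityMeasure_expMeasure H.α_pos
  have hα := H.α_pos
  have hc := H.c_pos
  have hfin : ∀ x, walkProb c (expMeasure α) G Set.univ x ≠ ⊤ := fun x =>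
    ((walkProb_le_one _ _ _ _ _).trans_lt ENNReal.one_lt_top).ne
  have hanti : Antitone (walkProb c (expMeasure α) G Set.univ) := fun x y hxy =>
    measure_mono fun q ⟨j, hj, hlt⟩ => ⟨j, hj, hxy.trans_lt hlt⟩
  have hmeas : Measurable (walkProb c (expMeasure α) G Set.univ) := hanti.measurable
  refine ⟨fun x y hxy => ENNReal.toReal_mono (hfin x) (hanti hxy), fun x => ENNReal.toReal_nonneg,
    fun x hx => ?_, fun x => ?_, fun x hx => ?_⟩
  · have : {q : (ℕ → ℝ) × (ℕ → ℝ) | ∃ j ∈ Set.univ,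
        x < ∑ k ∈ Finset.range j, (q.2 k - c * q.1 k)} = Set.univ :=
      Set.eq_univ_of_forall fun q => ⟨0, trivial, by simpa using hx⟩
    simp only [walkProb, this, measure_univ, ENNReal.toReal_one]
  · exact ENNReal.toReal_le_of_le_ofReal (Real.exp_pos _).le (H.walkProb_univ_le hκ hκ0 x)
  · have hin : ∀ y, (∫⁻ z, walkProb c (expMeasure α) G Set.univ (y - z) ∂G).toReal =
        ∫ z, (walkProb c (expMeasure α) G Set.univ (y - z)).toReal ∂G := fun y =>
      (integral_toReal (hmeas.comp (by fun_prop)).aemeasurable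
        (Eventually.of_forall fun z => (hfin _).lt_top)).symm
    have hm2 : Measurable fun t => ∫⁻ z, walkProb c (expMeasure α) G Set.univ (x + c * t - z) ∂G := by
      refine Measurable.lintegral_prod_right' (f := fun p : ℝ × ℝ =>
        walkProb c (expMeasure α) G Set.univ (x + c * p.1 - p.2)) (hmeas.comp (by fun_prop))
    rw [walkProb_step _ _ _ _ hx, Set.preimage_univ, ← integral_toReal hm2.aemeasurable
      (Eventually.of_forall fun t => ?_)]
    · simp only [hin]
      rw [integral_expMeasure hα]
      set B : ℝ → ℝ := fun y => ∫ z, (walkProb c (expMeasure α) G Set.univ (y - z)).toReal ∂G with hB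
      set g : ℝ → ℝ := fun u => α * Real.exp (-(α / c) * u) * B (x + u) with hg
      have e1 : ∀ t : ℝ, α * Real.exp (-α * t) * B (x + c * t) = g (c * t) := by
        intro t
        have : -(α / c) * (c * t) = -α * t := by field_simp
        simp only [hg, this]
      refine (integral_congr_ae (Eventually.of_forall e1)).trans ?_
      -- Substitute `u = c t`, then `s = x + u`, to pass from the inter-arrival time to the capital
      -- just before the first claim.
      rw [integral_comp_mul_left_Ioi g 0 hc, mul_zero, smul_eq_mul,
        ← integral_indicator measurableSet_Ioi,
        ← integral_sub_right_eq_self _ x, ← integral_const_mul, ← integral_indicator measurableSet_Ioi,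
        ← integral_const_mul]
      congr 1
      ext s
      simp only [Set.indicator_apply, Set.mem_Ioi, sub_pos, hg]
      split_ifs
      · have h3 : Real.exp (-(α / c) * (s - x)) =
            Real.exp (α / c * x) * Real.exp (-(α / c) * s) := by
          rw [← Real.exp_add]; ring_nf
        have h4 : x + (s - x) = s := by ring
        rw [h3, h4]
        field_simp
        rfl
      · simp
    · refine (lintegral_mono fun z => walkProb_le_one _ _ _ _ _).trans_lt ?_
      simp

end IsClaimModel

/-! ### Ruin as the event that the embedded random walk exceeds the initial capital -/

/-- The `n`-th arrival time of a counting path. -/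
def arrivalTime (n : ℕ) (p : ℝ≥0 → ℕ) : ℝ≥0∞ :=
  ⨅ q : ℚ, if n ≤ p (Real.toNNReal q) then ((Real.toNNReal q : ℝ≥0) : ℝ≥0∞) else ⊤

theorem measurable_arrivalTime (n : ℕ) : Measurable (arrivalTime n) := by
  refine Measurable.iInf fun q => Measurable.ite ?_ measurable_const measurable_const
  exact measurableSet_le measurable_const (measurable_pi_apply (Real.toNNReal q))

/-- Rational times suffice by density, and a countable infimum keeps the arrival time measurable for
the product σ-algebra on paths. -/
theorem arrivalTime_eq {n : ℕ} {p : ℝ≥0 → ℕ} {S : ℝ} (h : ∀ t : ℝ≥0, n ≤ p t ↔ S ≤ t) :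
    arrivalTime n p = ENNReal.ofReal S := by
  refine le_antisymm (le_of_forall_gt fun r hr => ?_) (le_iInf fun q => ?_)
  · obtain ⟨q, _, h1, h2⟩ := ENNReal.lt_iff_exists_rat_btwn.1 hr
    refine (iInf_le _ q).trans_lt ?_
    rw [if_pos]
    · exact h2
    · rw [h]
      rw [ENNReal.ofReal, ENNReal.coe_lt_coe] at h1
      exact (Real.le_coe_toNNReal S).trans (by exact_mod_cast h1.le)
  · split_ifs with hq
    · rw [h] at hq
      rw [ENNReal.ofReal, ENNReal.coe_le_coe]
      exact Real.toNNReal_le_iff_le_coe.2 hq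
    · exact le_top

/-- The inter-arrival times of a counting path. -/
def interarrival (p : ℝ≥0 → ℕ) (k : ℕ) : ℝ :=
  (arrivalTime (k + 1) p).toReal - (arrivalTime k p).toReal

theorem measurable_interarrival : Measurable interarrival :=
  measurable_pi_iff.2 fun k =>
    (measurable_arrivalTime (k + 1)).ennreal_toReal.sub (measurable_arrivalTime k).ennreal_toReal

theorem interarrival_eq {p : ℝ≥0 → ℕ} {T : ℕ → ℝ} (hT : ∀ k, 0 ≤ T k)
    (h : ∀ (t : ℝ≥0) (n : ℕ), n ≤ p t ↔ ∑ k ∈ Finset.range n, T k ≤ t) : interarrival p = T := by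
  ext k
  have hS : ∀ n, 0 ≤ ∑ k ∈ Finset.range n, T k := fun n => Finset.sum_nonneg fun k _ => hT k
  rw [interarrival, arrivalTime_eq fun t => h t (k + 1), arrivalTime_eq fun t => h t k,
    ENNReal.toReal_ofReal (hS _), ENNReal.toReal_ofReal (hS _), Finset.sum_range_succ]
  ring

theorem expMeasure_ae_nonneg (α : ℝ) : ∀ᵐ t ∂(expMeasure α), 0 ≤ t := by
  have hm : Measurable (exponentialPDF α) := (measurable_exponentialPDFReal α).ennreal_ofReal
  rw [ae_iff]
  have : {t : ℝ | ¬ 0 ≤ t} = Set.Iio 0 := by ext; simp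
  rw [this, expMeasure, gammaMeasure]
  change volume.withDensity (exponentialPDF α) _ = 0
  rw [withDensity_apply _ measurableSet_Iio, lintegral_exponentialPDF_of_nonpos le_rfl]

/-- If the capital is negative at time `t`, it already was at the last arrival up to `t`.
Conversely, take `t` to be the `j`-th arrival time; several arrivals may coincide there, so only `j
≤ p t` is known, and nonnegative claims make the surplus ones harmless. -/
theorem exists_risk_neg_iff {c x : ℝ} (hc : 0 < c) {p : ℝ≥0 → ℕ} {T Z : ℕ → ℝ}
    (hT : ∀ k, 0 ≤ T k) (hZ : ∀ k, 0 ≤ Z k)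
    (h : ∀ (t : ℝ≥0) (n : ℕ), n ≤ p t ↔ ∑ k ∈ Finset.range n, T k ≤ t) :
    (∃ t : ℝ≥0, x + c * t - ∑ k ∈ Finset.range (p t), Z k < 0) ↔
      ∃ j : ℕ, x < ∑ k ∈ Finset.range j, (Z k - c * T k) := by
  have hsum : ∀ j : ℕ, ∑ k ∈ Finset.range j, (Z k - c * T k) =
      ∑ k ∈ Finset.range j, Z k - c * ∑ k ∈ Finset.range j, T k := fun j => by
    rw [Finset.sum_sub_distrib, Finset.mul_sum]
  constructor
  · rintro ⟨t, ht⟩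
    refine ⟨p t, ?_⟩
    have h1 := mul_le_mul_of_nonneg_left ((h t (p t)).1 le_rfl) hc.le
    rw [hsum]
    linarith
  · rintro ⟨j, hj⟩
    have hS : 0 ≤ ∑ k ∈ Finset.range j, T k := Finset.sum_nonneg fun k _ => hT k
    refine ⟨⟨_, hS⟩, ?_⟩
    have h1 : j ≤ p ⟨_, hS⟩ := (h ⟨_, hS⟩ j).2 le_rfl
    have h2 : ∑ k ∈ Finset.range j, Z k ≤ ∑ k ∈ Finset.range (p ⟨_, hS⟩), Z k :=
      Finset.sum_le_sum_of_subset_of_nonneg (Finset.range_mono h1) fun k _ _ => hZ k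
    rw [hsum] at hj
    change x + c * (∑ k ∈ Finset.range j, T k) - _ < 0
    linarith

theorem ruinProb_eq_walkProb {Ω : Type*} [MeasurableSpace Ω] {P : Measure Ω} [IsProbabilityMeasure P]
    {α c : ℝ} (hc : 0 < c) {G : Measure ℝ} (hG_nonneg : G (Set.Iio 0) = 0)
    {N : ℝ≥0 → Ω → ℕ} {Z : ℕ → Ω → ℝ} (hN : IsPoissonProcess P α N)
    (hZ_meas : ∀ k, Measurable (Z k)) (hZ_law : ∀ k, P.map (Z k) = G) (hZ_indep : iIndepFun Z P)
    (hNZ : IndepFun (fun ω t => N t ω) (fun ω k => Z k ω) P) (x : ℝ) :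
    ruinProb P c N Z x = (walkProb c (expMeasure α) G Set.univ x).toReal := by
  obtain ⟨T, hT_meas, hT_law, hT_indep, hTN⟩ := hN.exists_interarrival
  have hT0 : ∀ᵐ ω ∂P, ∀ k, 0 ≤ T k ω := ae_all_iff.2 fun k =>
    ae_of_ae_map (hT_meas k).aemeasurable (by rw [hT_law k]; exact expMeasure_ae_nonneg α)
  have hZ0 : ∀ᵐ ω ∂P, ∀ k, 0 ≤ Z k ω := ae_all_iff.2 fun k =>
    ae_of_ae_map (hZ_meas k).aemeasurable (by
      rw [hZ_law k, ae_iff]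
      convert hG_nonneg using 2
      ext y; simp)
  have hTm : Measurable fun ω k => T k ω := measurable_pi_iff.2 hT_meas
  have hZm : Measurable fun ω k => Z k ω := measurable_pi_iff.2 hZ_meas
  -- Independence is assumed for the counting process. The inter-arrival times are almost surely a
  -- measurable function of its path, so they inherit it.
  have hTZ : IndepFun (fun ω k => T k ω) (fun ω k => Z k ω) P := by
    refine (hNZ.comp measurable_interarrival measurable_id).congr ?_ (EventuallyEq.refl _ _)
    filter_upwards [hT0, hTN] with ω h1 h2
    exact interarrival_eq h1 h2
  have hlaw : P.map (fun ω => ((fun k => T k ω), fun k => Z k ω)) =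
      (Measure.infinitePi fun _ : ℕ => expMeasure α).prod (Measure.infinitePi fun _ : ℕ => G) := by
    rw [(indepFun_iff_map_prod_eq_prod_map_map hTm.aemeasurable hZm.aemeasurable).1 hTZ,
      hT_indep.map_fun_eq_infinitePi_map hT_meas, hZ_indep.map_fun_eq_infinitePi_map hZ_meas]
    simp only [hT_law, hZ_law]
  have hm : MeasurableSet {q : (ℕ → ℝ) × (ℕ → ℝ) |
      ∃ j ∈ Set.univ, x < ∑ k ∈ Finset.range j, (q.2 k - c * q.1 k)} :=
    (measurableSet_walk c Set.univ).preimage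
      (measurable_const.prodMk measurable_id : Measurable fun q => (x, q))
  rw [walkProb, ← hlaw, Measure.map_apply (hTm.prodMk hZm) hm]
  refine measureReal_congr ?_
  filter_upwards [hT0, hZ0, hTN] with ω h1 h2 h3
  refine propext ?_
  change (⨅ t : ℝ≥0, ((riskProcess c N Z x t ω : ℝ) : EReal)) < 0 ↔
    ∃ j ∈ Set.univ, x < ∑ k ∈ Finset.range j, (Z k ω - c * T k ω)
  rw [iInf_lt_iff]
  simp only [Set.mem_univ, true_and]
  rw [← exists_risk_neg_iff hc h1 h2 h3]
  simp only [riskProcess]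
  exact exists_congr fun t => by norm_cast

end RuinTheory
end

/-! ### The expansion of the ruin probability -/

theorem mainTheorem3 {Ω : Type*} [MeasurableSpace Ω] (P : Measure Ω) [IsProbabilityMeasure P]
    (α c : ℝ) (hα : 0 < α) (hc : 0 < c)
    -- the claim size distribution, on `[0, ∞)` and not concentrated at `0`
    (G : Measure ℝ) [IsProbabilityMeasure G]
    (hG_nonneg : G (Set.Iio 0) = 0) (hG_ne : G ≠ Measure.dirac 0)
    -- the Poisson process and the i.i.d. claims, independent of each other
    (N : ℝ≥0 → Ω → ℕ) (Z : ℕ → Ω → ℝ)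
    (hN : RuinTheory.IsPoissonProcess P α N)
    (hZ_meas : ∀ k, Measurable (Z k)) (hZ_law : ∀ k, P.map (Z k) = G) (hZ_indep : iIndepFun Z P)
    (hNZ : IndepFun (fun ω t => N t ω) (fun ω k => Z k ω) P)
    -- finite moment generating function and positive safety loading
    (hmgf : ∀ s : ℝ, 0 < s → Integrable (fun y => Real.exp (s * y)) G)
    (hsafe : 0 < c - α * ∫ y, y ∂G) :
    ∃ κ : ℝ, 0 < κ ∧ (∀ s : ℝ, RuinTheory.LundbergEq α c G s ↔ s = κ) ∧
      IsProbabilityMeasure (RuinTheory.tiltedLadder α c κ G) ∧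
      Differentiable ℂ (RuinTheory.tiltedMGF α c κ G) ∧
      -- the expansion
      (∀ r : ℝ, 0 < r → ∃ S : Finset ℂ,
        (∀ z : ℂ, z ∈ S ↔ z.re ≤ r ∧ RuinTheory.tiltedMGF α c κ G z = 1) ∧ (0 : ℂ) ∈ S ∧
        (fun x : ℝ => (RuinTheory.ruinProb P c N Z x : ℂ) -
            ∑ z ∈ S, RuinTheory.expansionTerm α c κ G x z)
          =o[atTop] fun x : ℝ => Real.exp (-(r + κ) * x)) ∧
      -- the terms of simple roots
      (∀ z : ℂ, RuinTheory.tiltedMGF α c κ G z = 1 → deriv (RuinTheory.tiltedMGF α c κ G) z ≠ 0 →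
        ∀ x : ℝ,
          RuinTheory.expansionTerm α c κ G x z =
            -((α * (∫ y, y ∂G : ℝ) - c) / (c * deriv (RuinTheory.tiltedMGF α c κ G) z * (z + κ))) *
              Complex.exp (-x * (z + κ)) ∧
          RuinTheory.expansionTerm α c κ G x z =
            (c - α * (∫ y, y ∂G : ℝ)) / (α * (∫ y : ℝ, y * Complex.exp ((z + κ) * y) ∂G) - c) *
              Complex.exp (-(z + κ) * x)) ∧
      -- the root `0` is simple, and its term is the Cramér–Lundberg approximation
      deriv (RuinTheory.tiltedMGF α c κ G) 0 ≠ 0 ∧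
      (∀ x : ℝ, RuinTheory.expansionTerm α c κ G x 0 =
        ((c - α * ∫ y, y ∂G) / (α * (∫ y, y * Real.exp (κ * y) ∂G) - c) * Real.exp (-κ * x) : ℝ)) ∧
      RuinTheory.ruinProb P c N Z ~[atTop] fun x : ℝ =>
        (c - α * ∫ y, y ∂G) / (α * (∫ y, y * Real.exp (κ * y) ∂G) - c) * Real.exp (-κ * x) := by
  have H : RuinTheory.IsClaimModel α c G := ⟨hα, hc, inferInstance, hG_nonneg, hG_ne, hmgf, hsafe⟩
  obtain ⟨κ, hκ0, hκ⟩ := H.exists_adjustment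
  have hψ := H.isRuinFunction_walkProb hκ hκ0
  have heq : (fun x => (RuinTheory.walkProb c (expMeasure α) G Set.univ x).toReal) =ᶠ[atTop]
      RuinTheory.ruinProb P c N Z := by
    filter_upwards [eventually_ge_atTop 0] with x hx
    exact (RuinTheory.ruinProb_eq_walkProb hc hG_nonneg hN hZ_meas hZ_law hZ_indep hNZ x).symm
  refine ⟨κ, hκ0, fun s => ?_, H.isProbabilityMeasure_tiltedLadder hκ, H.differentiable_tiltedMGF,
    fun r hr => ?_, fun z hz hd x => ⟨H.expansionTerm_simple hz hd x, H.expansionTerm_simple' hz hd x⟩,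
    H.deriv_tiltedMGF_zero_ne, H.expansionTerm_zero hκ,
    (hψ.isEquivalent H hκ hκ0).congr_left heq⟩
  · rw [H.lundbergEq_iff, ← hκ]
    exact H.strictMono_mgf_ladder.injective.eq_iff
  · obtain ⟨S, hS, h0, hexp⟩ := hψ.exists_expansion H hκ hκ0 hr
    refine ⟨S, hS, h0, hexp.congr' ?_ EventuallyEq.rfl⟩
    filter_upwards [heq] with x hx
    rw [← hx]
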